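/- Let $q$ be a prime power, $A=\mathbb{F}_q[T]$, $K=\mathbb{F}_q(T)$ with the absolute value $|a|=q^{\deg a}$ ($0\ne a\in A$), $K_\infty$ the completion of $K$, $\mathbb{C}_\infty$ the completion of an algebraic closure of $K_\infty$, $\Omega=\mathbb{C}_\infty\setminus K_\infty$ and $\Gamma=\mathrm{GL}_2(A)$. Let $\tilde\pi$ be a fundamental period of the Carlitz module, i.e. $\tilde\pi\neq0$ and the kernel of the Carlitz exponential $\sum_{i\ge 0} z^{q^i}/D_i$, $D_i=\prod_{j<i}(T^{q^i}-T^{q^j})$, is $\tilde\pi A$. Put $u(z)=\tilde\pi^{-1}\sum_{a\in A}\frac{1}{z+a}$ for $z\in\Omega$. For $n\ge 1$ let $G_n\in\mathbb{C}_\infty[X]$ be the $n$-th Goss polynomial of the lattice $\tilde\pi A$, i.e. the polynomial with $G_n(u(z))=\tilde\pi^{-n}\sum_{a\in A}\frac{1}{(z+a)^n}$ for all $z\in\Omega$, and put $G_0=1$. Let $H\subset\Gamma$ be the subgroup of matrices with bottom row $(0,1)$. A function $f$ on $\Omega$ is a Drinfeld modular form of weight $k$ and type $m$ if it is rigid analytic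 on $\Omega$, satisfies $\frac{(\det\gamma)^m}{(cz+d)^k}f(\gamma z)=f(z)$ for all $\gamma=\begin{pmatrix}a&b\\c&d\end{pmatrix}\in\Gamma$ and $z\in\Omega$, and has an expansion $f(z)=\sum_{i\ge0}a_iu(z)^i$ ($a_i \in \mathbb{C}_\infty$) valid for all $z\in\Omega$ with $|z|_i=\inf_{x\in K_\infty}|z-x|$ sufficiently large. **Theorem.** Let $k,n$ be integers with $0\le n<k$, and let $m$ be the remainder of $n$ modulo $q-1$. For every $z\in\Omega$ the terms of the series $$P_{k,n}(z)=\sum_{\gamma\in H\backslash\Gamma}\frac{(\det\gamma)^m}{(cz+d)^k}\,G_n(u(\gamma z))$$ depend only on the cosets $H\gamma$, and the series converges unconditionally. The function $P_{k,n}$ is a Drinfeld modular form of weight $k$ and type $m$. If moreover $k\equiv 2n \pmod{q-1}$ and $n\le \frac{k}{q+1}$, then $P_{k,n}$ is not identically zero on $\Omega$. -/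

import Mathlib

open scoped Polynomial

namespace DrinfeldPoincare

noncomputable section

/-! Throughout, `F` is the finite field with `q` elements, `A = F[X]` and `K = RatFunc F`
(the variable `X` is the `T` of `𝔽_q[T]`). -/

/-- The absolute value on `K = 𝔽_q(T)` with `|a| = q ^ deg a` for nonzero polynomials `a`. -/
def absInfty (F : Type*) [Field F] [Fintype F] : AbsoluteValue (RatFunc F) ℝ where
  toFun x := open Classical in if x = 0 then 0 else (Fintype.card F : ℝ) ^ x.intDegree
  map_mul' x y := by
    have hq : (Fintype.card F : ℝ) ≠ 0 := by exact_mod_cast Fintype.card_ne_zero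
    by_cases hx : x = 0
    · simp [hx]
    · by_cases hy : y = 0
      · simp [hy]
      · simp [hx, hy, RatFunc.intDegree_mul hx hy, zpow_add₀ hq]
  nonneg' x := by
    split_ifs
    · exact le_rfl
    · positivity
  eq_zero' x := by
    have hq : (Fintype.card F : ℝ) ≠ 0 := by exact_mod_cast Fintype.card_ne_zero
    split_ifs with h
    · simp [h]
    · simp [h, hq, zpow_ne_zero]
  add_le' x y := by
    have hq : (1 : ℝ) ≤ Fintype.card F := by exact_mod_cast Fintype.card_pos
    by_cases hx : x = 0
    · subst hx
      rw [zero_add, if_pos rfl, zero_add]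
    by_cases hy : y = 0
    · subst hy
      rw [add_zero, if_pos rfl, add_zero]
    by_cases hxy : x + y = 0
    · simp only [hxy, hx, hy, if_true, if_false]
      positivity
    · simp only [hxy, hx, hy, if_false]
      rcases le_max_iff.mp (RatFunc.intDegree_add_le hy hxy) with h | h
      · exact (zpow_le_zpow_right₀ hq h).trans (le_add_of_nonneg_right (by positivity))
      · exact (zpow_le_zpow_right₀ hq h).trans (le_add_of_nonneg_left (by positivity))

/-- `K_∞`, the completion of `K` with respect to `|·|`. -/
abbrev KInfty (F : Type*) [Field F] [Fintype F] := (absInfty F).Completion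

instance (F : Type*) [Field F] [Fintype F] : IsUltrametricDist (WithAbs (absInfty F)) := by
  refine IsUltrametricDist.isUltrametricDist_of_forall_norm_add_le_max_norm fun x y => ?_
  have key : ∀ a b : RatFunc F,
      absInfty F (a + b) ≤ max (absInfty F a) (absInfty F b) := by
    intro x y
    have hq : (1 : ℝ) ≤ Fintype.card F := by exact_mod_cast Fintype.card_pos
    by_cases hx : x = 0
    · simp [hx]
    by_cases hy : y = 0
    · simp [hy]
    by_cases hxy : x + y = 0
    · rw [hxy, map_zero]
      exact le_max_of_le_left ((absInfty F).nonneg x)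
    · have h1 : ∀ z : RatFunc F, z ≠ 0 →
          absInfty F z = (Fintype.card F : ℝ) ^ z.intDegree := fun z hz => if_neg hz
      rw [h1 _ hx, h1 _ hy, h1 _ hxy]
      rcases le_max_iff.mp (RatFunc.intDegree_add_le hy hxy) with h | h
      · exact le_max_of_le_left (zpow_le_zpow_right₀ hq h)
      · exact le_max_of_le_right (zpow_le_zpow_right₀ hq h)
  exact key x.ofAbs y.ofAbs

instance (F : Type*) [Field F] [Fintype F] : IsUltrametricDist (KInfty F) := by
  refine IsUltrametricDist.isUltrametricDist_of_forall_norm_add_le_max_norm fun x y => ?_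
  induction x, y using UniformSpace.Completion.induction_on₂ with
  | hp => exact isClosed_le (by fun_prop) (by fun_prop)
  | ih a b =>
    rw [← UniformSpace.Completion.coe_add]
    simp only [UniformSpace.Completion.norm_coe]
    exact IsUltrametricDist.norm_add_le_max a b

instance (F : Type*) [Field F] [Fintype F] : NontriviallyNormedField (KInfty F) where
  non_trivial := by
    refine ⟨((WithAbs.toAbs (absInfty F) RatFunc.X : WithAbs (absInfty F)) : KInfty F), ?_⟩
    rw [UniformSpace.Completion.norm_coe]
    change 1 < absInfty F RatFunc.X
    have h : absInfty F RatFunc.X = (Fintype.card F : ℝ) ^ (RatFunc.X : RatFunc F).intDegree :=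
      if_neg RatFunc.X_ne_zero
    rw [h, RatFunc.intDegree_X, zpow_one]
    exact_mod_cast Fintype.one_lt_card

/-- A fixed algebraic closure of `K_∞`, with the unique extension of the absolute value. -/
abbrev KInftyAlgCl (F : Type*) [Field F] [Fintype F] := AlgebraicClosure (KInfty F)

instance (F : Type*) [Field F] [Fintype F] : NormedField (KInftyAlgCl F) :=
  spectralNorm.normedField (KInfty F) (KInftyAlgCl F)

/-- `ℂ_∞`, the completion of the algebraic closure of `K_∞`. -/
abbrev CInfty (F : Type*) [Field F] [Fintype F] := UniformSpace.Completion (KInftyAlgCl F)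

variable {F : Type*} [Field F] [Fintype F]

/-- The inclusion `K → K_∞`. -/
def ratToKInfty : RatFunc F →+* KInfty F :=
  UniformSpace.Completion.coeRingHom.comp
    (WithAbs.equiv (absInfty F)).symm.toRingHom

/-- The inclusion `K_∞ → ℂ_∞`. -/
def ofKInfty : KInfty F →+* CInfty F :=
  UniformSpace.Completion.coeRingHom.comp (algebraMap (KInfty F) (KInftyAlgCl F))

/-- The inclusion `A → ℂ_∞`. -/
def ofA : F[X] →+* CInfty F :=
  (ofKInfty.comp ratToKInfty).comp (algebraMap F[X] (RatFunc F))

/-- The Drinfeld upper half-plane `Ω = ℂ_∞ \ K_∞`. -/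
def Omega (F : Type*) [Field F] [Fintype F] : Set (CInfty F) :=
  {z | ∀ x : KInfty F, ofKInfty x ≠ z}

/-- The imaginary distance `|z|_i = inf_{x ∈ K_∞} |z - x|`. -/
def imDist (z : CInfty F) : ℝ := ⨅ x : KInfty F, ‖z - ofKInfty x‖

/-- `D_i = ∏_{j < i} (T ^ (q ^ i) - T ^ (q ^ j))`. -/
def carlitzD (F : Type*) [Field F] [Fintype F] (i : ℕ) : F[X] :=
  ∏ j ∈ Finset.range i,
    ((Polynomial.X : F[X]) ^ Fintype.card F ^ i - (Polynomial.X : F[X]) ^ Fintype.card F ^ j)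

/-- The exponential `e_C(z) = ∑ z ^ (q ^ i) / D_i` of the Carlitz module `C_T = T τ⁰ + τ`. -/
def carlitzExp (z : CInfty F) : CInfty F :=
  ∑' i : ℕ, z ^ Fintype.card F ^ i / ofA (carlitzD F i)

/-- `π` is a fundamental period of the Carlitz module: a generator of the period lattice
`ker e_C = π A`. -/
def IsFundamentalPeriod (π : CInfty F) : Prop :=
  π ≠ 0 ∧ ∀ z : CInfty F, carlitzExp z = 0 ↔ ∃ a : F[X], z = π * ofA a

/-- The uniformizer at infinity `u(z) = π⁻¹ ∑_{a ∈ A} 1 / (z + a)`. -/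
def unif (π z : CInfty F) : CInfty F := π⁻¹ * ∑' a : F[X], (z + ofA a)⁻¹

/-- `G` is an `n`-th Goss polynomial of the lattice `π A` (for `n ≥ 1`):
`G (u(z)) = π ^ (-n) ∑_{a ∈ A} 1 / (z + a) ^ n` for all `z ∈ Ω`.
For `n = 0`, where the sum makes no sense, the Goss polynomial is the monic polynomial of
degree `0`. -/
def IsGossPoly (π : CInfty F) (n : ℕ) (G : (CInfty F)[X]) : Prop :=
  if n = 0 then G = 1 else
    ∀ z ∈ Omega F, HasSum (fun a : F[X] => (π⁻¹) ^ n * ((z + ofA a)⁻¹) ^ n) (G.eval (unif π z))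

open Classical in
/-- The `n`-th Goss polynomial `G_n` of the lattice `π A`. -/
def gossPoly (π : CInfty F) (n : ℕ) : (CInfty F)[X] :=
  if h : ∃ G : (CInfty F)[X], IsGossPoly π n G then h.choose else 0

/-- `Γ = GL₂(A)`. -/
abbrev Gam (F : Type*) [Field F] := Matrix.GeneralLinearGroup (Fin 2) F[X]

/-- The `(i, j)` entry of `γ ∈ Γ`, as an element of `ℂ_∞`. -/
def entry (γ : Gam F) (i j : Fin 2) : CInfty F := ofA ((γ : Matrix (Fin 2) (Fin 2) F[X]) i j)

/-- `det γ`, as an element of `ℂ_∞`. -/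
def detC (γ : Gam F) : CInfty F := ofA (γ : Matrix (Fin 2) (Fin 2) F[X]).det

/-- `j_γ(z) = c z + d`. -/
def jFactor (γ : Gam F) (z : CInfty F) : CInfty F := entry γ 1 0 * z + entry γ 1 1

/-- `γ z = (a z + b) / (c z + d)`. -/
def moebius (γ : Gam F) (z : CInfty F) : CInfty F :=
  (entry γ 0 0 * z + entry γ 0 1) / jFactor γ z

/-- The slash operator of weight `k` and type `m`:
`(det γ) ^ m / (c z + d) ^ k * f (γ z)`. -/
def slash (k m : ℕ) (γ : Gam F) (f : CInfty F → CInfty F) (z : CInfty F) : CInfty F :=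
  detC γ ^ m / jFactor γ z ^ k * f (moebius γ z)

/-- The affinoid `Ω_r = {z : |z| ≤ q ^ r, |z - x| ≥ q ^ (-r) for all x ∈ K_∞}`; these exhaust `Ω`
and form an admissible covering. -/
def OmegaAff (F : Type*) [Field F] [Fintype F] (r : ℕ) : Set (CInfty F) :=
  {z | ‖z‖ ≤ (Fintype.card F : ℝ) ^ r ∧
    ∀ x : KInfty F, ((Fintype.card F : ℝ) ^ r)⁻¹ ≤ ‖z - ofKInfty x‖}

/-- `f` is rigid analytic on `Ω`: on each affinoid `Ω_r` it is a uniform limit of rational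
functions without poles on `Ω_r`. -/
def IsRigidAnalytic (f : CInfty F → CInfty F) : Prop :=
  ∀ r : ℕ, ∀ ε : ℝ, 0 < ε → ∃ P Q : (CInfty F)[X],
    (∀ z ∈ OmegaAff F r, Q.eval z ≠ 0) ∧
    ∀ z ∈ OmegaAff F r, ‖f z - P.eval z / Q.eval z‖ ≤ ε

/-- `f` (restricted to `Ω`) is a Drinfeld modular form for `Γ` of weight `k` and type `m`: it is
rigid analytic on `Ω`, it satisfies `f (γ z) = (det γ) ^ (-m) (c z + d) ^ k f z`, and it has an
expansion `∑ a_i u(z) ^ i` at infinity, valid for all `z` with `|z|_i` sufficiently large. -/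
structure IsDrinfeldModularForm (π : CInfty F) (k m : ℕ) (f : CInfty F → CInfty F) : Prop where
  rigidAnalytic : IsRigidAnalytic f
  slash_eq : ∀ γ : Gam F, ∀ z ∈ Omega F, slash k m γ f z = f z
  holomorphic_at_infty : ∃ a : ℕ → CInfty F, ∃ R : ℝ, ∀ z ∈ Omega F, R ≤ imDist z →
    HasSum (fun i : ℕ => a i * unif π z ^ i) (f z)

/-- The subgroup `H` of matrices in `Γ` with bottom row `(0, 1)`. -/
def subgroupH (F : Type*) [Field F] : Subgroup (Gam F) where
  carrier := {γ | (γ : Matrix (Fin 2) (Fin 2) F[X]) 1 0 = 0 ∧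
    (γ : Matrix (Fin 2) (Fin 2) F[X]) 1 1 = 1}
  one_mem' := by simp
  mul_mem' := by
    rintro x y ⟨hx0, hx1⟩ ⟨hy0, hy1⟩
    simp [Matrix.mul_apply, Fin.sum_univ_two, hx0, hx1, hy0, hy1]
  inv_mem' := by
    rintro x ⟨hx0, hx1⟩
    have h := congrArg (fun M : Gam F => (M : Matrix (Fin 2) (Fin 2) F[X])) (mul_inv_cancel x)
    have h0 := congrFun (congrFun h 1) 0
    have h1 := congrFun (congrFun h 1) 1
    simp only [Units.val_mul, Matrix.mul_apply, Fin.sum_univ_two, hx0, hx1, Units.val_one] at h0 h1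
    simp only [zero_mul, one_mul, zero_add] at h0 h1
    exact ⟨by simpa using h0, by simpa using h1⟩

/-- The set `H \ Γ` of cosets `H γ`. -/
abbrev Cosets (F : Type*) [Field F] := Quotient (QuotientGroup.rightRel (subgroupH F))

/-- The summand `(det γ) ^ m (c z + d) ^ (-k) G_n (u (γ z))`, where `m = n mod (q - 1)`. -/
def poincareTerm (π : CInfty F) (k n : ℕ) (γ : Gam F) (z : CInfty F) : CInfty F :=
  slash k (n % (Fintype.card F - 1)) γ (fun w => (gossPoly π n).eval (unif π w)) z

/-- The Drinfeld-Poincaré series `P_{k,n}(z) = ∑_{γ ∈ H \ Γ} (det γ)^m (c z + d)^(-k) G_n(u(γ z))`.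
Each coset is evaluated at a representative. -/
def poincareSeries (π : CInfty F) (k n : ℕ) (z : CInfty F) : CInfty F :=
  ∑' c : Cosets F, poincareTerm π k n (Quotient.out c) z

end

end DrinfeldPoincare

open DrinfeldPoincare

/-!
With `S_j(z) = ∑_{a ∈ A} (z + a)^(-j)` one has `u = π⁻¹ S_1` and `G_n(u) = π^(-n) S_n`, so that
`P_{k,n}` is `π^(-n)` times a series built from the lattice `A` alone.

*Goss polynomials.* Multiplying the series `S_j` and `S_1` and splitting the summands into partial
fractions expresses `S_{j+1}` through `S_1 S_j` and `S_1, …, S_j` with integral coefficients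
(`latSum_mul_latSum_one`). So `S_j` is a polynomial in `S_1` with coefficients of absolute value at
most `1` (`exists_latSum_eq_eval`).

*Convergence.* For `n = 0` the term of `γ` is `(c z + d)^(-k)`. For `n ≥ 1` and `γ` with rows
`(a, b)`, `(c, d)` it is, up to a constant,
`(c z + d)^(-(k-n)) ∑_{e ∈ A} ((a + e c) z + (b + e d))^(-n)` (`poincareTerm_eq`). On the affinoid
`Ω_r` every nonzero row satisfies `|a z + b| ≥ q^(-2r) max(|a|, |b|)` (`le_norm_linear`), so the
terms are `O(|c z + d|^(-(k-n)))` uniformly on `Ω_r`. As `k > n` they tend to `0`, which in a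
complete ultrametric field gives unconditional convergence; it is uniform on `Ω_r`, and the terms
are uniform limits of rational functions. The functional equation is the cocycle relation together
with right multiplication on `H \ Γ`.

*Expansion at infinity.* The cosets with `c = 0` give a multiple of `G_n(u)`. The others are the
translates of those with `deg d < deg c`, and the sum over all translates and over `e` becomes a
series of functions `∑_β (a (z + β) + b)^(-n) (c (z + β) + d)^(-(k-n))` with `a d - b c = 1`
(`poincareSeries_eq`, `tsum_poincareTerm_eq`). If `a = 0`, this is a multiple of `S_{k-n}`.
Otherwise the poles `-b/a` and `-d/c` differ by `1/(a c)`, so unless `a`, `c` are constants both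
have absolute value at most `1/q`, and the summand expands into inverse powers of `z + β` with
geometrically decreasing coefficients; summation over `β` gives a convergent series of `S_j`,
hence a power series in `S_1` with bounded coefficients. For constant `a`, `c` partial fractions
reduce to finitely many `S_j` (`hasExpansionAtInfty_rowSum`). The coefficient bounds `|a|^(-n)
|c|^(-(k-n))` tend to `0`, so these power series can be added up.

*Nonvanishing.* The series is evaluated at a `z` with `z^(q+1) = T`, where
`|a z + b| = max(|a| |z|, |b|)` and `1 < |z| < |z|^q < q`. If `k ≡ 2n` modulo `q - 1`, the cosets
with `c = 0` contribute `-π^(-n) S_n(z)`. Here `|S_n(z)| ≥ |z|^(-qn)`, because the summands over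
`𝔽_q`, multiplied by `∏_{x ∈ 𝔽_q} (z + x)^n`, add up to a nonzero polynomial over `𝔽_q` in `z`
(`le_norm_latSum`). Everything else is smaller than `|π|^(-n) |z|^(-qn)` if `k ≥ (q + 1) n`
(`norm_rowSum_lt`); in the boundary case this uses `|S_j(z)| < |z|^(-j)`, a consequence of
`∑_{x ∈ 𝔽_q} z^(-j) = 0`.
-/

/-! ### Series in complete ultrametric groups -/

section Ultrametric

open Filter Topology

variable {ι E : Type*} [NormedAddCommGroup E] [IsUltrametricDist E]

/-- Strict bounds pass to infinite sums, since all but finitely many terms are below `M / 2`. -/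
theorem norm_tsum_lt_of_forall_lt {f : ι → E} {M : ℝ} (hM : 0 < M) (h : ∀ i, ‖f i‖ < M) :
    ‖∑' i, f i‖ < M := by
  by_cases hf : Summable f
  · have h0 := hf.tendsto_cofinite_zero.norm
    rw [norm_zero] at h0
    have hs : {i | ¬ ‖f i‖ < M / 2}.Finite := h0.eventually (gt_mem_nhds (half_pos hM))
    have h1 : ∀ᶠ r in 𝓝[<] M, ∀ i ∈ {i | ¬ ‖f i‖ < M / 2}, ‖f i‖ ≤ r :=
      (eventually_all_finite hs).2 fun i _ => by
        filter_upwards [Ioo_mem_nhdsLT (h i)] with r hr using hr.1.le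
    obtain ⟨r, hr, hr1, hr2⟩ :=
      (h1.and (eventually_mem_set.2 (Ioo_mem_nhdsLT (half_lt_self hM)))).exists
    refine lt_of_le_of_lt (IsUltrametricDist.norm_tsum_le_of_forall_le_of_nonneg
      ((half_pos hM).le.trans hr1.le) fun i => ?_) hr2
    by_cases hi : ‖f i‖ < M / 2
    · exact (hi.trans hr1).le
    · exact hr i hi
  · rwa [tsum_eq_zero_of_not_summable hf, norm_zero]

theorem summable_of_norm_le_of_tendsto [CompleteSpace E] {f : ι → E} {g : ι → ℝ}
    (hg : Tendsto g cofinite (𝓝 0)) (h : ∀ i, ‖f i‖ ≤ g i) : Summable f :=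
  NonarchimedeanAddGroup.summable_of_tendsto_cofinite_zero (squeeze_zero_norm h hg)

theorem norm_pow_sub_pow_lt {C : Type*} [NormedField C] [IsUltrametricDist C] {u v : C} {r : ℝ}
    (hr : 0 < r) (hu : ‖u‖ ≤ r) (hv : ‖v‖ ≤ r) (huv : ‖u - v‖ < r) (j : ℕ) :
    ‖u ^ j - v ^ j‖ < r ^ j := by
  induction j with
  | zero => simp
  | succ j ih =>
    have h : u ^ (j + 1) - v ^ (j + 1) = u * (u ^ j - v ^ j) + (u - v) * v ^ j := by ring
    rw [h]
    refine (IsUltrametricDist.norm_add_le_max _ _).trans_lt (max_lt ?_ ?_)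
    · rw [norm_mul, pow_succ']
      exact mul_lt_mul' hu ih (norm_nonneg _) hr
    · rw [norm_mul, norm_pow, pow_succ']
      exact (mul_le_mul_of_nonneg_left (pow_le_pow_left₀ (norm_nonneg _) hv j)
        (norm_nonneg _)).trans_lt (mul_lt_mul_of_pos_right huv (pow_pos hr j))

theorem HasSum.congr_summand {ι M : Type*} [AddCommMonoid M] [TopologicalSpace M] {f g : ι → M}
    {x : M} (hf : HasSum f x) (h : ∀ i, g i = f i) : HasSum g x :=
  (funext h : g = f) ▸ hf

end Ultrametric

/-! ### Absolute values on `K`, `K_∞` and `ℂ_∞` -/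

namespace DrinfeldPoincare

open Filter Topology

variable {F : Type*} [Field F] [Fintype F]

instance : IsUltrametricDist (KInftyAlgCl F) := by
  refine IsUltrametricDist.isUltrametricDist_of_forall_norm_add_le_max_norm fun x y => ?_
  exact isNonarchimedean_spectralNorm (K := KInfty F) x y

instance : IsUltrametricDist (CInfty F) := by
  refine IsUltrametricDist.isUltrametricDist_of_forall_norm_add_le_max_norm fun x y => ?_
  induction x, y using UniformSpace.Completion.induction_on₂ with
  | hp => exact isClosed_le (by fun_prop) (by fun_prop)
  | ih a b =>
    rw [← UniformSpace.Completion.coe_add]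
    simp only [UniformSpace.Completion.norm_coe]
    exact IsUltrametricDist.norm_add_le_max a b

@[simp]
theorem norm_ofKInfty (x : KInfty F) : ‖ofKInfty x‖ = ‖x‖ := by
  have h : ‖ofKInfty x‖ = ‖algebraMap (KInfty F) (KInftyAlgCl F) x‖ :=
    UniformSpace.Completion.norm_coe _
  rw [h]
  exact spectralNorm_extends x

theorem norm_ratToKInfty (x : RatFunc F) : ‖ratToKInfty x‖ = absInfty F x :=
  UniformSpace.Completion.norm_coe _

theorem absInfty_of_ne_zero {x : RatFunc F} (hx : x ≠ 0) :
    absInfty F x = (Fintype.card F : ℝ) ^ x.intDegree := if_neg hx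

theorem norm_ofA {a : F[X]} (ha : a ≠ 0) : ‖ofA a‖ = (Fintype.card F : ℝ) ^ a.natDegree := by
  have h : ‖ofA a‖ = absInfty F (algebraMap F[X] (RatFunc F) a) := by
    rw [← norm_ratToKInfty, ← norm_ofKInfty]; rfl
  rw [h, absInfty_of_ne_zero (by simpa using ha), RatFunc.intDegree_polynomial, zpow_natCast]

theorem one_lt_card : (1 : ℝ) < Fintype.card F := by exact_mod_cast Fintype.one_lt_card

theorem card_pos : (0 : ℝ) < Fintype.card F := zero_lt_one.trans one_lt_card

theorem ofA_injective : Function.Injective (ofA : F[X] →+* CInfty F) := by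
  rw [injective_iff_map_eq_zero]
  intro a ha
  by_contra h
  have := norm_ofA h
  rw [ha, norm_zero] at this
  exact (pow_pos card_pos _).ne this

@[simp]
theorem ofA_eq_zero {a : F[X]} : ofA a = 0 ↔ a = 0 := map_eq_zero_iff _ ofA_injective

theorem one_le_norm_ofA {a : F[X]} (ha : a ≠ 0) : 1 ≤ ‖ofA a‖ := by
  rw [norm_ofA ha]; exact one_le_pow₀ one_lt_card.le

theorem norm_ofA_C {x : F} (hx : x ≠ 0) : ‖ofA (Polynomial.C x)‖ = 1 := by
  rw [norm_ofA (by simpa using hx)]; simp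

theorem norm_ofA_C_le (x : F) : ‖ofA (Polynomial.C x)‖ ≤ 1 := by
  by_cases hx : x = 0
  · simp [hx]
  · exact (norm_ofA_C hx).le

theorem norm_ofA_eq_one_of_isUnit {a : F[X]} (ha : IsUnit a) : ‖ofA a‖ = 1 := by
  rw [norm_ofA ha.ne_zero, Polynomial.natDegree_eq_zero_of_isUnit ha, pow_zero]

/-- The absolute value of a nonconstant polynomial is at least `q`. -/
theorem card_le_norm_ofA {a : F[X]} (ha : ¬ IsUnit a) (h0 : a ≠ 0) :
    (Fintype.card F : ℝ) ≤ ‖ofA a‖ := by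
  rw [norm_ofA h0]
  refine le_self_pow₀ one_lt_card.le fun h => ha ?_
  rw [Polynomial.isUnit_iff_degree_eq_zero, Polynomial.degree_eq_natDegree h0, h]; rfl

theorem norm_ofA_div_le {c d : F[X]} (hdc : d.degree < c.degree) :
    ‖ofA d / ofA c‖ ≤ (Fintype.card F : ℝ)⁻¹ := by
  have hc : c ≠ 0 := by rintro rfl; simp at hdc
  by_cases hd : d = 0
  · simp [hd]
  rw [norm_div, norm_ofA hc, norm_ofA hd, div_le_iff₀ (pow_pos card_pos _), inv_mul_eq_div,
    le_div_iff₀ card_pos, ← pow_succ]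
  exact pow_le_pow_right₀ one_lt_card.le (Polynomial.natDegree_lt_natDegree hd hdc)

theorem finite_norm_ofA_le (B : ℝ) : {a : F[X] | ‖ofA a‖ ≤ B}.Finite := by
  obtain ⟨N, hN⟩ := pow_unbounded_of_one_lt B (one_lt_card (F := F))
  have h : Finite (Polynomial.degreeLT F N) :=
    .of_equiv _ (Polynomial.degreeLTEquiv F N).symm.toEquiv
  refine (Set.toFinite (Polynomial.degreeLT F N : Set F[X])).subset fun a ha => ?_
  rw [SetLike.mem_coe, Polynomial.mem_degreeLT]
  by_cases h0 : a = 0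
  · simp [h0]
  rw [Set.mem_ofPred_eq, norm_ofA h0] at ha
  rw [Polynomial.degree_eq_natDegree h0, Nat.cast_lt]
  exact (pow_lt_pow_iff_right₀ one_lt_card).1 (ha.trans_lt hN)

theorem tendsto_norm_ofA : Tendsto (fun a : F[X] => ‖ofA a‖) cofinite atTop := by
  rw [tendsto_atTop]
  intro B
  refine ((finite_norm_ofA_le (F := F) B).subset fun a ha => ?_ : Set.Finite _)
  simp only [Set.mem_compl_iff, Set.mem_ofPred_eq, not_le] at ha ⊢
  exact ha.le

theorem card_cast_eq_zero : (Fintype.card F : CInfty F) = 0 := by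
  have h : ((Fintype.card F : ℕ) : F[X]) = 0 := by
    rw [← map_natCast Polynomial.C, Nat.cast_card_eq_zero, map_zero]
  rw [← map_natCast (ofA : F[X] →+* CInfty F), h, map_zero]

theorem ofA_C_pow_card_sub_one {x : F} (hx : x ≠ 0) :
    ofA (Polynomial.C x) ^ (Fintype.card F - 1) = 1 := by
  rw [← map_pow, ← map_pow, FiniteField.pow_card_sub_one_eq_one x hx, map_one, map_one]

/-! ### The upper half-plane -/

/-- On the affinoid `Ω_r` the linear forms `a z + b` are bounded below uniformly. -/
theorem le_norm_linear {r : ℕ} {z : CInfty F} (hz : z ∈ OmegaAff F r) (a b : F[X]) :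
    (((Fintype.card F : ℝ) ^ r) ^ 2)⁻¹ * max ‖ofA a‖ ‖ofA b‖ ≤ ‖ofA a * z + ofA b‖ := by
  set Q : ℝ := (Fintype.card F : ℝ) ^ r with hQ
  have hQ1 : 1 ≤ Q := one_le_pow₀ one_lt_card.le
  have hQ0 : 0 < Q := zero_lt_one.trans_le hQ1
  obtain ⟨hz1, hz2⟩ := hz
  have ha : Q⁻¹ * ‖ofA a‖ ≤ ‖ofA a * z + ofA b‖ := by
    by_cases h0 : a = 0
    · simp [h0]
    have h0' : ofA a ≠ 0 := by simpa using h0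
    have h1 := hz2 (-(ratToKInfty (algebraMap F[X] (RatFunc F) b) /
      ratToKInfty (algebraMap F[X] (RatFunc F) a)))
    have h2 : z - ofKInfty (-(ratToKInfty (algebraMap F[X] (RatFunc F) b) /
      ratToKInfty (algebraMap F[X] (RatFunc F) a))) = (ofA a * z + ofA b) / ofA a := by
      rw [map_neg, map_div₀]
      change z - -(ofA b / ofA a) = _
      rw [sub_neg_eq_add]
      field_simp
    rw [h2, norm_div, le_div_iff₀ (norm_pos_iff.2 h0')] at h1
    exact h1
  have hQi : (Q ^ 2)⁻¹ ≤ Q⁻¹ := by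
    gcongr
    exact le_self_pow₀ hQ1 two_ne_zero
  rw [mul_max_of_nonneg _ _ (by positivity)]
  refine max_le ((mul_le_mul_of_nonneg_right hQi (norm_nonneg _)).trans ha) ?_
  rcases lt_or_ge ‖ofA a * z‖ ‖ofA b‖ with h | h
  · rw [IsUltrametricDist.norm_add_eq_max_of_norm_ne_norm h.ne, max_eq_right h.le]
    exact mul_le_of_le_one_left (norm_nonneg _) (inv_le_one_of_one_le₀ (one_le_pow₀ hQ1))
  · rw [norm_mul] at h
    have h3 : ‖ofA b‖ ≤ ‖ofA a‖ * Q := h.trans (by gcongr)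
    calc (Q ^ 2)⁻¹ * ‖ofA b‖ ≤ (Q ^ 2)⁻¹ * (‖ofA a‖ * Q) := by gcongr
      _ = Q⁻¹ * ‖ofA a‖ := by field_simp
      _ ≤ _ := ha

theorem isClosed_range_ofKInfty : IsClosed (Set.range (ofKInfty : KInfty F →+* CInfty F)) := by
  have h : Isometry (ofKInfty : KInfty F →+* CInfty F) :=
    AddMonoidHomClass.isometry_of_norm _ norm_ofKInfty
  exact h.isClosedEmbedding.isClosed_range

theorem mem_Omega_iff {z : CInfty F} : z ∈ Omega F ↔ ∃ r, z ∈ OmegaAff F r := by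
  constructor
  · intro hz
    have h : (Set.range (ofKInfty : KInfty F →+* CInfty F))ᶜ ∈ 𝓝 z :=
      isClosed_range_ofKInfty.isOpen_compl.mem_nhds (by rintro ⟨x, hx⟩; exact hz x hx)
    obtain ⟨ε, hε, hb⟩ := Metric.mem_nhds_iff.1 h
    obtain ⟨r, hr⟩ := pow_unbounded_of_one_lt (max ‖z‖ ε⁻¹) (one_lt_card (F := F))
    refine ⟨r, (le_max_left _ _).trans hr.le, fun x => ?_⟩
    have h1 : ε ≤ ‖z - ofKInfty x‖ := by
      by_contra hlt
      push Not at hlt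
      refine hb (Metric.mem_ball.2 ?_) ⟨x, rfl⟩
      rwa [dist_comm, dist_eq_norm]
    exact (inv_le_of_inv_le₀ hε ((le_max_right _ _).trans hr.le)).trans h1
  · rintro ⟨r, hr⟩ x rfl
    have := hr.2 x
    rw [sub_self, norm_zero] at this
    exact absurd this (not_le.2 (inv_pos.2 (pow_pos card_pos _)))

theorem OmegaAff_subset (r : ℕ) : OmegaAff F r ⊆ Omega F := fun _ hz => mem_Omega_iff.2 ⟨r, hz⟩

theorem one_le_max_norm {a b : F[X]} (h : a ≠ 0 ∨ b ≠ 0) : 1 ≤ max ‖ofA a‖ ‖ofA b‖ := by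
  rcases h with h | h
  · exact le_max_of_le_left (one_le_norm_ofA h)
  · exact le_max_of_le_right (one_le_norm_ofA h)

theorem linear_ne_zero {z : CInfty F} (hz : z ∈ Omega F) {a b : F[X]} (h : a ≠ 0 ∨ b ≠ 0) :
    ofA a * z + ofA b ≠ 0 := by
  obtain ⟨r, hr⟩ := mem_Omega_iff.1 hz
  rw [← norm_pos_iff]
  exact lt_of_lt_of_le (mul_pos (inv_pos.2 (pow_pos (pow_pos card_pos _) _))
    (zero_lt_one.trans_le (one_le_max_norm h))) (le_norm_linear hr a b)

theorem norm_inv_linear_le {r : ℕ} {z : CInfty F} (hz : z ∈ OmegaAff F r) {a b : F[X]}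
    (h : a ≠ 0 ∨ b ≠ 0) :
    ‖(ofA a * z + ofA b)⁻¹‖ ≤ ((Fintype.card F : ℝ) ^ r) ^ 2 * (max ‖ofA a‖ ‖ofA b‖)⁻¹ := by
  have h1 := le_norm_linear hz a b
  have hQ : 0 < ((Fintype.card F : ℝ) ^ r) ^ 2 := pow_pos (pow_pos card_pos _) _
  have h2 := zero_lt_one.trans_le (one_le_max_norm h)
  rw [norm_inv]
  exact (inv_anti₀ (by positivity) h1).trans (by rw [mul_inv, inv_inv])

theorem add_ofA_ne_zero {z : CInfty F} (hz : z ∈ Omega F) (a : F[X]) : z + ofA a ≠ 0 := by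
  simpa using linear_ne_zero hz (a := 1) (b := a) (Or.inl one_ne_zero)

theorem add_ofA_mem_Omega {z : CInfty F} (hz : z ∈ Omega F) (a : F[X]) : z + ofA a ∈ Omega F := by
  intro x hx
  refine hz (x - ratToKInfty (algebraMap F[X] (RatFunc F) a)) ?_
  rw [map_sub, hx]
  exact add_sub_cancel_right _ _

theorem imDist_le (z : CInfty F) (x : KInfty F) : imDist z ≤ ‖z - ofKInfty x‖ :=
  ciInf_le ⟨0, by rintro _ ⟨y, rfl⟩; exact norm_nonneg _⟩ x

theorem imDist_le_norm_add (z : CInfty F) (a : F[X]) : imDist z ≤ ‖z + ofA a‖ := by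
  have := imDist_le z (-ratToKInfty (algebraMap F[X] (RatFunc F) a))
  rw [map_neg, sub_neg_eq_add] at this
  exact this

theorem tendsto_norm_add_ofA (z : CInfty F) :
    Tendsto (fun a : F[X] => ‖z + ofA a‖) cofinite atTop := by
  refine tendsto_atTop_mono (fun a => ?_) (tendsto_atTop_add_const_right _ (-‖z‖) tendsto_norm_ofA)
  have := norm_sub_norm_le (ofA a) (-z)
  rw [norm_neg, sub_neg_eq_add, add_comm (ofA a)] at this
  linarith

end DrinfeldPoincare

namespace DrinfeldPoincare

open Filter Topology

variable {F : Type*} [Field F] [Fintype F]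

/-! ### Lattice sums and Goss polynomials -/

noncomputable section

/-- The lattice sum `S_j(z) = ∑_{a ∈ A} (z + a)^(-j)`, an `A`-periodic function on `Ω` for
`j ≥ 1`. -/
def latSum (j : ℕ) (z : CInfty F) : CInfty F := ∑' a : F[X], ((z + ofA a)⁻¹) ^ j

/-- The power sum `∑_{0 ≠ c ∈ A} c^(-j)` for `j ≥ 1`; the summand at `c = 0` is the junk value
`0`. -/
def powSum (F : Type*) [Field F] [Fintype F] (j : ℕ) : CInfty F := ∑' c : F[X], ((ofA c)⁻¹) ^ j

theorem tendsto_inv_pow (z : CInfty F) {j : ℕ} (hj : j ≠ 0) :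
    Tendsto (fun a : F[X] => ((z + ofA a)⁻¹) ^ j) cofinite (𝓝 0) := by
  rw [tendsto_zero_iff_norm_tendsto_zero]
  have := ((tendsto_norm_add_ofA z).inv_tendsto_atTop).pow j
  simpa [hj] using this

theorem summable_latSum (z : CInfty F) {j : ℕ} (hj : j ≠ 0) :
    Summable (fun a : F[X] => ((z + ofA a)⁻¹) ^ j) :=
  NonarchimedeanAddGroup.summable_of_tendsto_cofinite_zero (tendsto_inv_pow z hj)

theorem hasSum_latSum (z : CInfty F) {j : ℕ} (hj : j ≠ 0) :
    HasSum (fun a : F[X] => ((z + ofA a)⁻¹) ^ j) (latSum j z) := (summable_latSum z hj).hasSum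

theorem hasSum_powSum {j : ℕ} (hj : j ≠ 0) :
    HasSum (fun c : F[X] => ((ofA c)⁻¹) ^ j) (powSum F j) := by
  have := hasSum_latSum (0 : CInfty F) hj
  simp only [zero_add] at this
  exact this.summable.hasSum

theorem norm_inv_ofA_le_one (c : F[X]) : ‖(ofA c)⁻¹‖ ≤ 1 := by
  by_cases hc : c = 0
  · simp [hc]
  · rw [norm_inv]; exact inv_le_one_of_one_le₀ (one_le_norm_ofA hc)

theorem norm_powSum_le (j : ℕ) : ‖powSum F j‖ ≤ 1 :=
  IsUltrametricDist.norm_tsum_le_of_forall_le_of_nonneg zero_le_one fun c => by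
    rw [norm_pow]; exact pow_le_one₀ (norm_nonneg _) (norm_inv_ofA_le_one c)

theorem latSum_add_ofA (j : ℕ) (z : CInfty F) (b : F[X]) :
    latSum j (z + ofA b) = latSum j z := by
  unfold latSum
  rw [← (Equiv.addLeft b).tsum_eq (fun a => ((z + ofA a)⁻¹) ^ j)]
  simp [add_assoc]

theorem latSum_C_mul (j : ℕ) (z : CInfty F) {x : F} (hx : x ≠ 0) :
    latSum j (ofA (Polynomial.C x) * z) = (ofA (Polynomial.C x))⁻¹ ^ j * latSum j z := by
  unfold latSum
  have hu : IsUnit (Polynomial.C x : F[X]) := by simpa using hx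
  rw [← tsum_mul_left, ← hu.unit.mulLeft.tsum_eq]
  refine tsum_congr fun a => ?_
  simp only [Units.mulLeft_apply, IsUnit.unit_spec, map_mul]
  rw [← mul_add, mul_inv, mul_pow]

theorem partial_fraction {K : Type*} [Field K] {x c : K} (hx : x ≠ 0) (hc : c ≠ 0)
    (hxc : x + c ≠ 0) (j : ℕ) :
    x⁻¹ ^ j * (x + c)⁻¹ = ∑ i ∈ Finset.range j, (-1) ^ i * c⁻¹ ^ (i + 1) * x⁻¹ ^ (j - i) +
      (-1) ^ j * c⁻¹ ^ j * (x + c)⁻¹ := by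
  induction j with
  | zero => simp
  | succ j ih =>
    have h : x⁻¹ ^ (j + 1) * (x + c)⁻¹ = c⁻¹ * (x⁻¹ ^ (j + 1) - x⁻¹ ^ j * (x + c)⁻¹) := by
      rw [pow_succ, show x⁻¹ ^ j * x⁻¹ - x⁻¹ ^ j * (x + c)⁻¹ = x⁻¹ ^ j * (x⁻¹ - (x + c)⁻¹) by ring,
        inv_sub_inv hx hxc, add_sub_cancel_left]
      field_simp
    rw [h, ih, Finset.sum_range_succ']
    have h2 : ∀ i, (-1 : K) ^ (i + 1) * c⁻¹ ^ (i + 1 + 1) * x⁻¹ ^ (j + 1 - (i + 1)) =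
        -c⁻¹ * ((-1) ^ i * c⁻¹ ^ (i + 1) * x⁻¹ ^ (j - i)) := fun i => by
      rw [Nat.add_sub_add_right]; ring
    simp only [h2, ← Finset.mul_sum]
    simp only [Nat.sub_zero]
    ring

instance : NonarchimedeanRing (CInfty F) where
  is_nonarchimedean := NonarchimedeanAddGroup.is_nonarchimedean

/-- The product of two lattice sums, obtained by expanding `S_j(z) S_1(z)` as a double series over
`(a, a + c)` and splitting `(z + a)^(-j) (z + a + c)^(-1)` into partial fractions for `c ≠ 0`.
It expresses `S_{j+1}` through `S_1, …, S_j`. -/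
theorem latSum_mul_latSum_one {z : CInfty F} (hz : z ∈ Omega F) {j : ℕ} (hj : j ≠ 0) :
    latSum j z * latSum 1 z = latSum (j + 1) z +
      ∑ i ∈ Finset.range j, (-1) ^ i * powSum F (i + 1) * latSum (j - i) z +
      (-1) ^ j * powSum F j * latSum 1 z := by
  classical
  have h1 := (hasSum_latSum z hj).mul_of_nonarchimedean (hasSum_latSum z one_ne_zero)
  rw [← (Equiv.prodShear (Equiv.refl F[X]) (fun a => Equiv.addLeft a)).hasSum_iff] at h1
  have h2 := (hasSum_latSum z (Nat.succ_ne_zero j)).mul_of_nonarchimedean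
    (hasSum_ite_eq (0 : F[X]) (1 : CInfty F))
  have h3 : ∀ i ∈ Finset.range j, HasSum
      (fun p : F[X] × F[X] => (-1) ^ i * (((z + ofA p.1)⁻¹) ^ (j - i) * ((ofA p.2)⁻¹) ^ (i + 1)))
      ((-1) ^ i * (latSum (j - i) z * powSum F (i + 1))) := fun i hi =>
    ((hasSum_latSum z (Nat.sub_ne_zero_of_lt (Finset.mem_range.1 hi))).mul_of_nonarchimedean
      (hasSum_powSum (Nat.succ_ne_zero i))).mul_left _
  have h4 := ((hasSum_latSum z one_ne_zero).mul_of_nonarchimedean (hasSum_powSum hj)).mul_left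
    ((-1) ^ j)
  rw [← ((Equiv.prodComm _ _).trans ((Equiv.prodShear (Equiv.refl F[X])
    (fun a => Equiv.addRight a)).trans (Equiv.prodComm _ _))).hasSum_iff] at h4
  have h5 := (h2.add (hasSum_sum h3)).add h4
  have key := h1.unique (a₂ := _) (by
    convert h5 using 1
    ext ⟨a, c⟩
    simp only [Function.comp, Equiv.prodShear_apply, Equiv.refl_apply, Equiv.coe_addLeft,
      Equiv.trans_apply, Equiv.prodComm_apply, Prod.swap, Equiv.coe_addRight, pow_one, map_add]
    by_cases hc : c = 0
    · simp [hc, hj, pow_succ]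
    · have := partial_fraction (add_ofA_ne_zero hz a) (c := ofA c) (by simpa using hc)
        (by simpa [add_assoc] using add_ofA_ne_zero hz (a + c)) j
      rw [add_assoc] at this
      rw [this]
      simp only [hc, if_false, mul_zero, zero_add]
      congr 1
      · exact Finset.sum_congr rfl fun i _ => by ring
      · ring)
  rw [key, mul_one]
  congr 1
  · congr 1
    exact Finset.sum_congr rfl fun i _ => by ring
  · ring

/-- Goss polynomials exist: `S_j` is a polynomial in `S_1`, and this polynomial has integral
coefficients. -/
theorem exists_latSum_eq_eval {j : ℕ} (hj : j ≠ 0) :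
    ∃ G : (CInfty F)[X], (∀ i, ‖G.coeff i‖ ≤ 1) ∧
      ∀ z ∈ Omega F, latSum j z = G.eval (latSum 1 z) := by
  induction j using Nat.strong_induction_on with
  | _ j ih =>
  obtain _ | _ | j := j
  · exact absurd rfl hj
  · refine ⟨Polynomial.X, fun i => ?_, fun z _ => by simp⟩
    rw [Polynomial.coeff_X]
    split_ifs <;> simp
  · choose! G hG1 hG2 using ih
    have hm : ∀ (c x : CInfty F) (i : ℕ), ‖c‖ ≤ 1 → ‖x‖ ≤ 1 → ‖(-1) ^ i * c * x‖ ≤ 1 := by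
      intro c x i hc hx
      rw [norm_mul, norm_mul, norm_pow, norm_neg, norm_one, one_pow, one_mul]
      exact mul_le_one₀ hc (norm_nonneg _) hx
    refine ⟨Polynomial.X * G (j + 1) - (∑ i ∈ Finset.range (j + 1),
      Polynomial.C ((-1) ^ i * powSum F (i + 1)) * G (j + 1 - i) +
      Polynomial.C ((-1) ^ (j + 1) * powSum F (j + 1)) * Polynomial.X), fun i => ?_,
      fun z hz => ?_⟩
    · rw [Polynomial.coeff_sub]
      rw [sub_eq_add_neg]
      refine (IsUltrametricDist.norm_add_le_max _ _).trans (max_le ?_ ?_)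
      · rcases i with _ | i
        · simp
        · rw [Polynomial.coeff_X_mul]; exact hG1 (j + 1) (by omega) (by omega) i
      · rw [norm_neg, Polynomial.coeff_add, Polynomial.finsetSum_coeff]
        refine (IsUltrametricDist.norm_add_le_max _ _).trans (max_le ?_ ?_)
        · refine IsUltrametricDist.norm_sum_le_of_forall_le_of_nonneg zero_le_one fun l hl => ?_
          rw [Polynomial.coeff_C_mul]
          have := Finset.mem_range.1 hl
          exact hm _ _ _ (norm_powSum_le _) (hG1 (j + 1 - l) (by omega) (by omega) i)
        · rw [Polynomial.coeff_C_mul, Polynomial.coeff_X]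
          refine hm _ _ _ (norm_powSum_le _) ?_
          split_ifs <;> simp
    · have h := latSum_mul_latSum_one hz (j := j + 1) (Nat.succ_ne_zero j)
      have h2 : ∀ i ∈ Finset.range (j + 1), latSum (j + 1 - i) z =
          (G (j + 1 - i)).eval (latSum 1 z) := fun i hi => by
        have := Finset.mem_range.1 hi
        exact hG2 (j + 1 - i) (by omega) (by omega) z hz
      simp only [Polynomial.eval_sub, Polynomial.eval_mul, Polynomial.eval_X, Polynomial.eval_add,
        Polynomial.eval_finsetSum, Polynomial.eval_C]
      rw [← hG2 (j + 1) (by omega) (by omega) z hz,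
        ← Finset.sum_congr rfl fun i hi => congrArg _ (h2 i hi), mul_comm, h]
      ring

theorem unif_eq (π z : CInfty F) : unif π z = π⁻¹ * latSum 1 z := by
  simp [unif, latSum]

theorem gossPoly_zero (π : CInfty F) : gossPoly π 0 = 1 := by
  have h : ∃ G : (CInfty F)[X], IsGossPoly π 0 G := ⟨1, by simp [IsGossPoly]⟩
  have h2 := h.choose_spec
  unfold gossPoly
  rw [dif_pos h]
  simpa [IsGossPoly] using h2

theorem gossPoly_eval {π : CInfty F} (hπ : π ≠ 0) {n : ℕ} (hn : n ≠ 0) {z : CInfty F}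
    (hz : z ∈ Omega F) :
    (gossPoly π n).eval (unif π z) = π⁻¹ ^ n * latSum n z := by
  have h : ∃ G : (CInfty F)[X], IsGossPoly π n G := by
    obtain ⟨G, -, hG⟩ := exists_latSum_eq_eval (F := F) hn
    refine ⟨Polynomial.C (π⁻¹ ^ n) * G.comp (Polynomial.C π * Polynomial.X), ?_⟩
    rw [IsGossPoly, if_neg hn]
    intro w hw
    have := (hasSum_latSum w hn).mul_left (π⁻¹ ^ n)
    rw [hG w hw] at this
    simpa [unif_eq, hπ] using this
  have h2 := h.choose_spec
  rw [IsGossPoly, if_neg hn] at h2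
  rw [gossPoly, dif_pos h]
  exact (h2 z hz).unique ((hasSum_latSum z hn).mul_left _)

end

end DrinfeldPoincare

namespace DrinfeldPoincare

open Filter Topology

/-! ### The action of `GL₂(A)` and the terms of the Poincaré series -/

section Cosets

variable {F : Type*} [Field F]

theorem isUnit_det (γ : Gam F) : IsUnit (γ : Matrix (Fin 2) (Fin 2) F[X]).det :=
  (Matrix.isUnit_iff_isUnit_det _).1 γ.isUnit

theorem bottom_row_ne_zero (γ : Gam F) : (γ : Matrix (Fin 2) (Fin 2) F[X]) 1 0 ≠ 0 ∨
    (γ : Matrix (Fin 2) (Fin 2) F[X]) 1 1 ≠ 0 := by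
  by_contra! h
  have := isUnit_det γ
  rw [Matrix.det_fin_two, h.1, h.2] at this
  simp at this

theorem row_ne_zero (γ : Gam F) (e : F[X]) :
    γ.val 0 0 + e * γ.val 1 0 ≠ 0 ∨ γ.val 0 1 + e * γ.val 1 1 ≠ 0 := by
  by_contra! h
  have hd := isUnit_det γ
  rw [Matrix.det_fin_two, show γ.val 0 0 * γ.val 1 1 - γ.val 0 1 * γ.val 1 0 = 0 by
    linear_combination γ.val 1 1 * h.1 - γ.val 1 0 * h.2] at hd
  exact not_isUnit_zero hd

theorem row_injective (γ : Gam F) : Function.Injective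
    (fun e : F[X] => (γ.val 0 0 + e * γ.val 1 0, γ.val 0 1 + e * γ.val 1 1)) := by
  intro e e' h
  simp only [Prod.mk.injEq, add_right_inj] at h
  rcases bottom_row_ne_zero γ with h0 | h0
  · exact mul_right_cancel₀ h0 h.1
  · exact mul_right_cancel₀ h0 h.2

/-- A coset `H γ` is determined by the bottom row of `γ`. -/
theorem coset_eq_of_bottom_row {γ γ' : Gam F}
    (h : (γ : Matrix (Fin 2) (Fin 2) F[X]) 1 = (γ' : Matrix (Fin 2) (Fin 2) F[X]) 1) :
    (⟦γ⟧ : Cosets F) = ⟦γ'⟧ := by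
  refine Quotient.sound (QuotientGroup.rightRel_apply.2 ?_)
  have h1 : ∀ j, ((γ' * γ⁻¹ : Gam F) : Matrix (Fin 2) (Fin 2) F[X]) 1 j =
      (1 : Matrix (Fin 2) (Fin 2) F[X]) 1 j := fun j => by
    rw [Units.val_mul, Matrix.mul_apply, ← h, ← Matrix.mul_apply, Units.mul_inv]
  exact ⟨by rw [h1]; simp, by rw [h1]; simp⟩

theorem bottom_row_eq_of_coset_eq {γ γ' : Gam F} (h : (⟦γ⟧ : Cosets F) = ⟦γ'⟧) :
    (γ : Matrix (Fin 2) (Fin 2) F[X]) 1 = (γ' : Matrix (Fin 2) (Fin 2) F[X]) 1 := by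
  obtain ⟨h0, h1⟩ := QuotientGroup.rightRel_apply.1 (Quotient.exact h)
  have h2 : γ' = (γ' * γ⁻¹) * γ := by group
  ext j
  conv_rhs => rw [h2, Units.val_mul, Matrix.mul_apply, Fin.sum_univ_two, h0, h1]
  simp

/-- Right multiplication by `δ` on `H \ Γ`. -/
noncomputable def cosetMulRight (δ : Gam F) : Cosets F ≃ Cosets F :=
  Quotient.congr (Equiv.mulRight δ) fun γ γ' => by
    rw [QuotientGroup.rightRel_apply, QuotientGroup.rightRel_apply]
    simp [mul_assoc]

end Cosets

variable {F : Type*} [Field F] [Fintype F]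

theorem norm_detC (γ : Gam F) : ‖detC γ‖ = 1 := norm_ofA_eq_one_of_isUnit (isUnit_det γ)

theorem detC_ne_zero (γ : Gam F) : detC γ ≠ 0 := by
  rw [← norm_pos_iff, norm_detC]; exact one_pos

theorem detC_eq (γ : Gam F) : detC γ = entry γ 0 0 * entry γ 1 1 - entry γ 0 1 * entry γ 1 0 := by
  simp [detC, entry, Matrix.det_fin_two]

theorem detC_mul (γ δ : Gam F) : detC (γ * δ) = detC γ * detC δ := by
  simp [detC]

theorem jFactor_ne_zero (γ : Gam F) {z : CInfty F} (hz : z ∈ Omega F) : jFactor γ z ≠ 0 :=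
  linear_ne_zero hz (bottom_row_ne_zero γ)

theorem moebius_mem_Omega (γ : Gam F) {z : CInfty F} (hz : z ∈ Omega F) :
    moebius γ z ∈ Omega F := by
  intro x hx
  have hj := jFactor_ne_zero γ hz
  rw [moebius, eq_div_iff hj, jFactor] at hx
  let κ : F[X] → KInfty F := fun a => ratToKInfty (algebraMap F[X] (RatFunc F) a)
  have hκ : ∀ i l, entry γ i l = ofKInfty (κ ((γ : Matrix (Fin 2) (Fin 2) F[X]) i l)) :=
    fun _ _ => rfl
  by_cases h : entry γ 0 0 - entry γ 1 0 * ofKInfty x = 0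
  · refine detC_ne_zero γ ?_
    rw [detC_eq]
    linear_combination (entry γ 1 1) * h + (entry γ 1 0) * (hx + z * h)
  · refine hz ((κ ((γ : Matrix (Fin 2) (Fin 2) F[X]) 1 1) * x -
      κ ((γ : Matrix (Fin 2) (Fin 2) F[X]) 0 1)) / (κ ((γ : Matrix (Fin 2) (Fin 2) F[X]) 0 0) -
      κ ((γ : Matrix (Fin 2) (Fin 2) F[X]) 1 0) * x)) ?_
    simp only [map_div₀, map_sub, map_mul, ← hκ]
    rw [div_eq_iff h]
    linear_combination hx

theorem entry_mul (γ δ : Gam F) (i l : Fin 2) :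
    entry (γ * δ) i l = entry γ i 0 * entry δ 0 l + entry γ i 1 * entry δ 1 l := by
  simp [entry, Matrix.mul_apply, Fin.sum_univ_two]

theorem jFactor_mul (γ δ : Gam F) {z : CInfty F} (hz : z ∈ Omega F) :
    jFactor (γ * δ) z = jFactor γ (moebius δ z) * jFactor δ z := by
  have h := jFactor_ne_zero δ hz
  rw [jFactor, jFactor, moebius, add_mul, mul_assoc, div_mul_cancel₀ _ h]
  simp only [entry_mul, jFactor]
  ring

theorem moebius_mul (γ δ : Gam F) {z : CInfty F} (hz : z ∈ Omega F) :
    moebius (γ * δ) z = moebius γ (moebius δ z) := by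
  have h := jFactor_ne_zero δ hz
  have h2 := jFactor_ne_zero γ (moebius_mem_Omega δ hz)
  change _ / _ = (entry γ 0 0 * moebius δ z + entry γ 0 1) / jFactor γ (moebius δ z)
  rw [jFactor_mul γ δ hz, div_eq_div_iff (mul_ne_zero h2 h) h2]
  have h3 : moebius δ z * jFactor δ z = entry δ 0 0 * z + entry δ 0 1 := div_mul_cancel₀ _ h
  have h4 : jFactor δ z = entry δ 1 0 * z + entry δ 1 1 := rfl
  simp only [entry_mul]
  linear_combination (-jFactor γ (moebius δ z)) * (entry γ 0 0 * h3 + entry γ 0 1 * h4)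

/-- The slash operators form a right action. -/
theorem slash_mul (k m : ℕ) (γ δ : Gam F) (f : CInfty F → CInfty F) {z : CInfty F}
    (hz : z ∈ Omega F) : slash k m (γ * δ) f z = slash k m δ (slash k m γ f) z := by
  rw [slash, slash, slash, jFactor_mul γ δ hz, moebius_mul γ δ hz, detC_mul, mul_pow, mul_pow]
  ring

theorem poincareTerm_mul (π : CInfty F) (k n : ℕ) (γ δ : Gam F) {z : CInfty F}
    (hz : z ∈ Omega F) : poincareTerm π k n (γ * δ) z =
      detC δ ^ (n % (Fintype.card F - 1)) / jFactor δ z ^ k *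
        poincareTerm π k n γ (moebius δ z) :=
  slash_mul _ _ _ _ _ hz

theorem pow_mod_card_sub_one {x : F} (hx : x ≠ 0) (n : ℕ) :
    ofA (Polynomial.C x) ^ (n % (Fintype.card F - 1)) = ofA (Polynomial.C x) ^ n := by
  conv_rhs => rw [← Nat.mod_add_div n (Fintype.card F - 1), pow_add, pow_mul,
    ofA_C_pow_card_sub_one hx, one_pow, mul_one]

theorem ofA_C_ne_zero {x : F} (hx : x ≠ 0) : ofA (Polynomial.C x) ≠ 0 := by simpa using hx

/-- Invariance of `G_n(u(z))` under `H`: the factor `x^(-n)` from `S_n(x z + b) = x^(-n) S_n(z)`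
cancels `(det h)^m = x^m`, as `m ≡ n` modulo `q - 1`. -/
theorem poincareTerm_of_mem_subgroupH {π : CInfty F} (hπ : π ≠ 0) (k n : ℕ) {h : Gam F}
    (hh : h ∈ subgroupH F) {z : CInfty F} (hz : z ∈ Omega F) :
    poincareTerm π k n h z = (gossPoly π n).eval (unif π z) := by
  obtain ⟨h0, h1⟩ := hh
  have hd : (h : Matrix (Fin 2) (Fin 2) F[X]).det =
      (h : Matrix (Fin 2) (Fin 2) F[X]) 0 0 := by
    rw [Matrix.det_fin_two, h0, h1]; simp
  have hu := isUnit_det h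
  rw [hd, Polynomial.isUnit_iff] at hu
  obtain ⟨x, hx, hx2⟩ := hu
  have hx := hx.ne_zero
  have hj : jFactor h z = 1 := by simp [jFactor, entry, h0, h1]
  have hm : moebius h z = ofA (Polynomial.C x) * z + entry h 0 1 := by
    rw [moebius, hj, div_one, hx2]; rfl
  have hdet : detC h = ofA (Polynomial.C x) := by rw [detC, hd, hx2]
  rw [poincareTerm, slash, hj, one_pow, div_one, hdet, pow_mod_card_sub_one hx]
  rcases eq_or_ne n 0 with rfl | hn
  · simp [gossPoly_zero]
  · rw [gossPoly_eval hπ hn (moebius_mem_Omega h hz), gossPoly_eval hπ hn hz, hm]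
    unfold entry
    rw [latSum_add_ofA, latSum_C_mul n z hx, inv_pow (ofA _)]
    field_simp [ofA_C_ne_zero hx]

/-- The terms of the Poincaré series depend only on the coset `H γ`. -/
theorem poincareTerm_subgroupH_mul {π : CInfty F} (hπ : π ≠ 0) (k n : ℕ) {h : Gam F}
    (hh : h ∈ subgroupH F) (γ : Gam F) {z : CInfty F} (hz : z ∈ Omega F) :
    poincareTerm π k n (h * γ) z = poincareTerm π k n γ z := by
  rw [poincareTerm_mul π k n h γ hz,
    poincareTerm_of_mem_subgroupH hπ k n hh (moebius_mem_Omega γ hz)]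
  rfl

theorem poincareTerm_congr {π : CInfty F} (hπ : π ≠ 0) (k n : ℕ) {γ γ' : Gam F}
    (h : (⟦γ⟧ : Cosets F) = ⟦γ'⟧) {z : CInfty F} (hz : z ∈ Omega F) :
    poincareTerm π k n γ z = poincareTerm π k n γ' z := by
  have h2 := QuotientGroup.rightRel_apply.1 (Quotient.exact h)
  rw [← poincareTerm_subgroupH_mul hπ k n h2 γ hz, inv_mul_cancel_right]

theorem poincareTerm_out {π : CInfty F} (hπ : π ≠ 0) (k n : ℕ) (γ : Gam F) {z : CInfty F}
    (hz : z ∈ Omega F) :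
    poincareTerm π k n (Quotient.out (⟦γ⟧ : Cosets F)) z = poincareTerm π k n γ z :=
  poincareTerm_congr hπ k n (Quotient.out_eq _) hz

/-- The term of a matrix `γ` with rows `(a, b)` and `(c, d)` is, up to a constant,
`(c z + d)^(-(k - n)) ∑_{e ∈ A} ((a + e c) z + (b + e d))^(-n)`, because
`γ z + e = ((a + e c) z + (b + e d)) / (c z + d)`. -/
theorem poincareTerm_eq {π : CInfty F} (hπ : π ≠ 0) {k n : ℕ} (hn : n ≠ 0) (hkn : n < k)
    (γ : Gam F) {z : CInfty F} (hz : z ∈ Omega F) :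
    poincareTerm π k n γ z = π⁻¹ ^ n * detC γ ^ (n % (Fintype.card F - 1)) *
      ∑' e : F[X], (((entry γ 0 0 + ofA e * entry γ 1 0) * z +
        (entry γ 0 1 + ofA e * entry γ 1 1))⁻¹ ^ n * (jFactor γ z)⁻¹ ^ (k - n)) := by
  have hj := jFactor_ne_zero γ hz
  rw [poincareTerm, slash, gossPoly_eval hπ hn (moebius_mem_Omega γ hz), latSum]
  rw [← tsum_mul_left, ← tsum_mul_left, ← tsum_mul_left]
  refine tsum_congr fun e => ?_
  have h : moebius γ z + ofA e = ((entry γ 0 0 + ofA e * entry γ 1 0) * z +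
        (entry γ 0 1 + ofA e * entry γ 1 1)) / jFactor γ z := by
    rw [moebius, eq_div_iff hj, add_mul, div_mul_cancel₀ _ hj]
    simp only [jFactor]
    ring
  obtain ⟨l, rfl⟩ := Nat.exists_eq_add_of_lt hkn
  rw [h, inv_div, div_pow, show n + l + 1 - n = l + 1 by omega, div_eq_mul_inv _ (_ ^ n),
    ← inv_pow (_ + _) n, show n + l + 1 = n + (l + 1) by ring, pow_add (jFactor γ z) n,
    inv_pow (jFactor γ z)]
  generalize ((entry γ 0 0 + ofA e * entry γ 1 0) * z + _)⁻¹ ^ n = Y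
  field_simp

theorem poincareTerm_zero (π : CInfty F) (k : ℕ) (γ : Gam F) (z : CInfty F) :
    poincareTerm π k 0 γ z = (jFactor γ z)⁻¹ ^ k := by
  simp [poincareTerm, slash, gossPoly_zero]

/-- For `n < k` the terms of the Poincaré series are `O(|c z + d|^(-(k - n)))`, uniformly on
`Ω_r`: every nonzero row `(a, b)` satisfies `|a z + b| ≥ q^(-2 r)` there. -/
theorem norm_poincareTerm_le {π : CInfty F} (hπ : π ≠ 0) {k n : ℕ} (hkn : n < k)
    (γ : Gam F) {r : ℕ} {z : CInfty F} (hz : z ∈ OmegaAff F r) :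
    ‖poincareTerm π k n γ z‖ ≤
      (‖π‖⁻¹ * ((Fintype.card F : ℝ) ^ r) ^ 2) ^ n * ‖jFactor γ z‖⁻¹ ^ (k - n) := by
  have hzO := OmegaAff_subset r hz
  rcases eq_or_ne n 0 with rfl | hn
  · simp [poincareTerm_zero]
  rw [poincareTerm_eq hπ hn hkn γ hzO, norm_mul, norm_mul, norm_pow, norm_pow (detC γ), norm_detC,
    one_pow, mul_one, norm_inv, mul_pow, mul_assoc]
  have hQ : 0 < (((Fintype.card F : ℝ) ^ r) ^ 2) := pow_pos (pow_pos card_pos _) _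
  refine mul_le_mul_of_nonneg_left ?_ (by positivity)
  refine IsUltrametricDist.norm_tsum_le_of_forall_le_of_nonneg (by positivity) fun e => ?_
  rw [norm_mul, norm_pow, norm_pow, norm_inv, norm_inv]
  refine mul_le_mul_of_nonneg_right ?_ (by positivity)
  refine pow_le_pow_left₀ (by positivity) (inv_le_of_inv_le₀ hQ ?_) _
  have h := le_norm_linear hz (γ.val 0 0 + e * γ.val 1 0) (γ.val 0 1 + e * γ.val 1 1)
  refine le_trans (le_mul_of_one_le_right (inv_pos.2 hQ).le
    (one_le_max_norm (row_ne_zero γ e))) ?_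
  simpa only [map_add, map_mul, entry] using h

theorem tendsto_max_norm_ofA :
    Tendsto (fun p : F[X] × F[X] => max ‖ofA p.1‖ ‖ofA p.2‖) cofinite atTop := by
  rw [tendsto_atTop]
  intro B
  refine (((finite_norm_ofA_le (F := F) B).prod (finite_norm_ofA_le (F := F) B)).subset
    fun p hp => ?_ : Set.Finite _)
  simp only [Set.mem_compl_iff, Set.mem_ofPred_eq, not_le, Set.mem_prod] at hp ⊢
  exact ⟨(le_max_left _ _).trans hp.le, (le_max_right _ _).trans hp.le⟩

/-- A bound for the terms of the Poincaré series on `Ω_r` that tends to `0` along the cosets. -/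
theorem exists_bound_poincareTerm {π : CInfty F} (hπ : π ≠ 0) {k n : ℕ} (hkn : n < k) (r : ℕ) :
    ∃ g : Cosets F → ℝ, Tendsto g cofinite (𝓝 0) ∧ ∀ c, ∀ z ∈ OmegaAff F r,
      ‖poincareTerm π k n (Quotient.out c) z‖ ≤ g c := by
  set Q : ℝ := ((Fintype.card F : ℝ) ^ r) ^ 2 with hQ'
  have hQ : 0 < Q := pow_pos (pow_pos card_pos _) _
  let row : Cosets F → F[X] × F[X] := fun c =>
    ((c.out : Matrix (Fin 2) (Fin 2) F[X]) 1 0, (c.out : Matrix (Fin 2) (Fin 2) F[X]) 1 1)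
  have hrow : Function.Injective row := fun c c' h => by
    rw [← Quotient.out_eq c, ← Quotient.out_eq c']
    refine coset_eq_of_bottom_row ?_
    ext j : 1
    fin_cases j
    · exact congrArg Prod.fst h
    · exact congrArg Prod.snd h
  refine ⟨fun c => (‖π‖⁻¹ * Q) ^ n * (Q⁻¹ * max ‖ofA (row c).1‖ ‖ofA (row c).2‖)⁻¹ ^ (k - n),
    ?_, fun c z hz => ?_⟩
  · have h1 := ((tendsto_max_norm_ofA.comp hrow.tendsto_cofinite).const_mul_atTop
      (inv_pos.2 hQ)).inv_tendsto_atTop.pow (k - n)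
    rw [zero_pow (Nat.sub_ne_zero_of_lt hkn)] at h1
    simpa using h1.const_mul ((‖π‖⁻¹ * Q) ^ n)
  · refine (norm_poincareTerm_le hπ hkn _ hz).trans ?_
    have h1 := le_norm_linear hz (row c).1 (row c).2
    have h2 := zero_lt_one.trans_le (one_le_max_norm (bottom_row_ne_zero c.out))
    refine mul_le_mul_of_nonneg_left (pow_le_pow_left₀ (by positivity) ?_ _) (by positivity)
    exact inv_anti₀ (by positivity) h1

theorem summable_poincareTerm {π : CInfty F} (hπ : π ≠ 0) {k n : ℕ} (hkn : n < k)
    {z : CInfty F} (hz : z ∈ Omega F) :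
    Summable (fun c : Cosets F => poincareTerm π k n (Quotient.out c) z) := by
  obtain ⟨r, hr⟩ := mem_Omega_iff.1 hz
  obtain ⟨g, hg, hb⟩ := exists_bound_poincareTerm hπ hkn r
  exact summable_of_norm_le_of_tendsto hg fun c => hb c z hr

theorem slash_poincareSeries {π : CInfty F} (hπ : π ≠ 0) (k n : ℕ) (δ : Gam F) {z : CInfty F}
    (hz : z ∈ Omega F) :
    slash k (n % (Fintype.card F - 1)) δ (poincareSeries π k n) z = poincareSeries π k n z := by
  have h : ∀ c : Cosets F, poincareTerm π k n (cosetMulRight δ c).out z =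
      detC δ ^ (n % (Fintype.card F - 1)) / jFactor δ z ^ k *
        poincareTerm π k n c.out (moebius δ z) := fun c => by
    rw [← poincareTerm_mul π k n _ δ hz, ← poincareTerm_out hπ k n (c.out * δ) hz]
    congr 2
    conv_lhs => rw [← Quotient.out_eq c]
    rfl
  calc _ = ∑' c : Cosets F, detC δ ^ (n % (Fintype.card F - 1)) / jFactor δ z ^ k *
        poincareTerm π k n c.out (moebius δ z) := tsum_mul_left.symm
    _ = ∑' c : Cosets F, poincareTerm π k n (cosetMulRight δ c).out z :=
        tsum_congr fun c => (h c).symm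
    _ = _ := (cosetMulRight δ).tsum_eq fun c : Cosets F => poincareTerm π k n c.out z

end DrinfeldPoincare

namespace DrinfeldPoincare

open Filter Topology

/-! ### Uniform limits of rational functions -/

section UniformRational

variable {C : Type*} [NormedField C]

/-- `f` is on `S` a uniform limit of rational functions without poles on `S`. -/
def IsUniformLimitOfRational (S : Set C) (f : C → C) : Prop :=
  ∀ ε : ℝ, 0 < ε → ∃ P Q : C[X], (∀ z ∈ S, Q.eval z ≠ 0) ∧
    ∀ z ∈ S, ‖f z - P.eval z / Q.eval z‖ ≤ ε

variable {S : Set C} {f g : C → C}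

theorem IsUniformLimitOfRational.of_eqOn_div {P Q : C[X]} (hQ : ∀ z ∈ S, Q.eval z ≠ 0)
    (h : ∀ z ∈ S, f z = P.eval z / Q.eval z) : IsUniformLimitOfRational S f := fun ε hε =>
  ⟨P, Q, hQ, fun z hz => by rw [h z hz, sub_self, norm_zero]; exact hε.le⟩

theorem IsUniformLimitOfRational.congr (hf : IsUniformLimitOfRational S f)
    (h : ∀ z ∈ S, g z = f z) : IsUniformLimitOfRational S g := fun ε hε => by
  obtain ⟨P, Q, h1, h2⟩ := hf ε hε
  exact ⟨P, Q, h1, fun z hz => by rw [h z hz]; exact h2 z hz⟩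

variable [IsUltrametricDist C]

theorem IsUniformLimitOfRational.add (hf : IsUniformLimitOfRational S f)
    (hg : IsUniformLimitOfRational S g) : IsUniformLimitOfRational S (fun z => f z + g z) :=
  fun ε hε => by
  obtain ⟨P, Q, h1, h2⟩ := hf ε hε
  obtain ⟨P', Q', h1', h2'⟩ := hg ε hε
  refine ⟨P * Q' + P' * Q, Q * Q', fun z hz => ?_, fun z hz => ?_⟩
  · rw [Polynomial.eval_mul]; exact mul_ne_zero (h1 z hz) (h1' z hz)
  · have h : f z + g z - (P * Q' + P' * Q).eval z / (Q * Q').eval z =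
        (f z - P.eval z / Q.eval z) + (g z - P'.eval z / Q'.eval z) := by
      have := h1 z hz
      have := h1' z hz
      simp only [Polynomial.eval_mul, Polynomial.eval_add]
      field_simp
      ring
    rw [h]
    exact (IsUltrametricDist.norm_add_le_max _ _).trans (max_le (h2 z hz) (h2' z hz))

theorem IsUniformLimitOfRational.sum {ι : Type*} {f : ι → C → C} (s : Finset ι)
    (hf : ∀ i, IsUniformLimitOfRational S (f i)) :
    IsUniformLimitOfRational S (fun z => ∑ i ∈ s, f i z) := by
  classical
  induction s using Finset.induction_on with
  | empty => exact .of_eqOn_div (P := 0) (Q := 1) (by simp) (by simp)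
  | insert i s hi ih =>
    simp only [Finset.sum_insert hi]
    exact (hf i).add ih

/-- A uniformly convergent series of such functions is again one: all but finitely many terms are
below `ε`. -/
theorem IsUniformLimitOfRational.tsum [CompleteSpace C] {ι : Type*} {f : ι → C → C} {g : ι → ℝ}
    (hg : Tendsto g cofinite (𝓝 0)) (hf : ∀ i, IsUniformLimitOfRational S (f i))
    (hb : ∀ i, ∀ z ∈ S, ‖f i z‖ ≤ g i) :
    IsUniformLimitOfRational S (fun z => ∑' i, f i z) := fun ε hε => by
  have hs : {i | ¬ g i < ε}.Finite := hg.eventually (gt_mem_nhds hε)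
  obtain ⟨P, Q, h1, h2⟩ := IsUniformLimitOfRational.sum hs.toFinset hf ε hε
  refine ⟨P, Q, h1, fun z hz => ?_⟩
  have hsum := summable_of_norm_le_of_tendsto hg fun i => hb i z hz
  beta_reduce
  rw [← hsum.sum_add_tsum_subtype_compl hs.toFinset, add_sub_right_comm]
  refine (IsUltrametricDist.norm_add_le_max _ _).trans (max_le (h2 z hz) ?_)
  refine IsUltrametricDist.norm_tsum_le_of_forall_le_of_nonneg hε.le fun i => ?_
  have hi := i.2
  simp only [Set.Finite.mem_toFinset, Set.mem_ofPred_eq, not_not] at hi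
  exact (hb i z hz).trans hi.le

end UniformRational

variable {F : Type*} [Field F] [Fintype F]

/-! ### Rigid analyticity -/

theorem isUniformLimitOfRational_linear (r : ℕ) {a b c d : F[X]} (hab : a ≠ 0 ∨ b ≠ 0)
    (hcd : c ≠ 0 ∨ d ≠ 0) (x : CInfty F) (n l : ℕ) :
    IsUniformLimitOfRational (OmegaAff F r)
      (fun z => x * ((ofA a * z + ofA b)⁻¹ ^ n * (ofA c * z + ofA d)⁻¹ ^ l)) := by
  refine .of_eqOn_div (P := Polynomial.C x)
    (Q := (Polynomial.C (ofA a) * Polynomial.X + Polynomial.C (ofA b)) ^ n *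
      (Polynomial.C (ofA c) * Polynomial.X + Polynomial.C (ofA d)) ^ l) (fun z hz => ?_)
      fun z hz => ?_
  · have h1 := linear_ne_zero (OmegaAff_subset r hz) hab
    have h2 := linear_ne_zero (OmegaAff_subset r hz) hcd
    rw [Polynomial.eval_mul, Polynomial.eval_pow, Polynomial.eval_pow]
    refine mul_ne_zero (pow_ne_zero _ ?_) (pow_ne_zero _ ?_) <;> simpa
  · simp only [Polynomial.eval_mul, Polynomial.eval_pow, Polynomial.eval_add, Polynomial.eval_C,
      Polynomial.eval_X, div_eq_mul_inv, mul_inv, inv_pow]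

theorem isUniformLimitOfRational_poincareTerm {π : CInfty F} (hπ : π ≠ 0) {k n : ℕ} (hkn : n < k)
    (γ : Gam F) (r : ℕ) :
    IsUniformLimitOfRational (OmegaAff F r) (poincareTerm π k n γ) := by
  set Q : ℝ := ((Fintype.card F : ℝ) ^ r) ^ 2 with hQ'
  have hQ : 0 < Q := pow_pos (pow_pos card_pos _) _
  rcases eq_or_ne n 0 with rfl | hn
  · refine (isUniformLimitOfRational_linear r (bottom_row_ne_zero γ) (bottom_row_ne_zero γ)
      1 0 k).congr fun z _ => ?_
    rw [poincareTerm_zero, pow_zero, one_mul, one_mul]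
    rfl
  obtain ⟨x, hx⟩ : ∃ x, x = π⁻¹ ^ n * detC γ ^ (n % (Fintype.card F - 1)) := ⟨_, rfl⟩
  have h1 := IsUniformLimitOfRational.tsum (S := OmegaAff F r) (f := fun e z =>
    x * ((ofA (γ.val 0 0 + e * γ.val 1 0) * z + ofA (γ.val 0 1 + e * γ.val 1 1))⁻¹ ^ n *
      (ofA (γ.val 1 0) * z + ofA (γ.val 1 1))⁻¹ ^ (k - n)))
    (g := fun e => ‖x‖ * ((Q * (max ‖ofA (γ.val 0 0 + e * γ.val 1 0)‖
      ‖ofA (γ.val 0 1 + e * γ.val 1 1)‖)⁻¹) ^ n * Q ^ (k - n))) ?_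
    (fun e => isUniformLimitOfRational_linear r (row_ne_zero γ e) (bottom_row_ne_zero γ) _ _ _)
    (fun e z hz => ?_)
  · refine h1.congr fun z hz => ?_
    rw [poincareTerm_eq hπ hn hkn γ (OmegaAff_subset r hz), ← hx, ← tsum_mul_left]
    simp only [map_add, map_mul]
    rfl
  · have h2 := (((tendsto_max_norm_ofA.comp
      (row_injective γ).tendsto_cofinite).inv_tendsto_atTop.const_mul Q).pow n).mul_const
      (Q ^ (k - n)) |>.const_mul ‖x‖
    simpa [hn] using h2
  · rw [norm_mul, norm_mul, norm_pow, norm_pow]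
    have h2 := norm_inv_linear_le hz (row_ne_zero γ e)
    have h3 := norm_inv_linear_le hz (bottom_row_ne_zero γ)
    have h4 : Q * (max ‖ofA (γ.val 1 0)‖ ‖ofA (γ.val 1 1)‖)⁻¹ ≤ Q :=
      mul_le_of_le_one_right hQ.le
        (inv_le_one_of_one_le₀ (one_le_max_norm (bottom_row_ne_zero γ)))
    refine mul_le_mul_of_nonneg_left (mul_le_mul (pow_le_pow_left₀ (norm_nonneg _) h2 _)
      (pow_le_pow_left₀ (norm_nonneg _) (h3.trans h4) _) (by positivity) ?_) (norm_nonneg _)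
    exact pow_nonneg ((norm_nonneg _).trans h2) _

theorem isRigidAnalytic_poincareSeries {π : CInfty F} (hπ : π ≠ 0) {k n : ℕ} (hkn : n < k) :
    IsRigidAnalytic (poincareSeries π k n) := fun r => by
  obtain ⟨g, hg, hb⟩ := exists_bound_poincareTerm hπ hkn r
  exact IsUniformLimitOfRational.tsum hg
    (fun c => isUniformLimitOfRational_poincareTerm hπ hkn c.out r) hb

end DrinfeldPoincare

/-! ### Expansion of rational functions in `1 / w` -/

section Laurent

open Filter Topology

variable {C : Type*} [NormedField C] [IsUltrametricDist C] [CompleteSpace C]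

/-- Multiplication by `(w + x)⁻¹` with `|x| ≤ θ < 1` preserves the functions on `|w| ≥ 1` with an
expansion `∑ c_l w^(-N-l)`, `|c_l| ≤ θ^l`, and raises `N` by one. -/
theorem exists_expansion_inv_mul {θ : ℝ} (hθ0 : 0 ≤ θ) (hθ : θ < 1) {x : C} (hx : ‖x‖ ≤ θ) {N : ℕ}
    {f : C → C} (h : ∃ c : ℕ → C, (∀ l, ‖c l‖ ≤ θ ^ l) ∧
      ∀ w, 1 ≤ ‖w‖ → HasSum (fun l => c l * w⁻¹ ^ (N + l)) (f w)) :
    ∃ c : ℕ → C, (∀ l, ‖c l‖ ≤ θ ^ l) ∧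
      ∀ w, 1 ≤ ‖w‖ → HasSum (fun l => c l * w⁻¹ ^ (N + 1 + l)) ((w + x)⁻¹ * f w) := by
  obtain ⟨c, hc, hf⟩ := h
  -- The coefficients `c'` solve `(w + x) ∑ c'_l w^(-N-1-l) = ∑ c_l w^(-N-l)`.
  let c' : ℕ → C := fun l => Nat.rec (c 0) (fun l y => c (l + 1) - x * y) l
  have hc' : ∀ l, ‖c' l‖ ≤ θ ^ l := fun l => by
    induction l with
    | zero => exact hc 0
    | succ l ih =>
      change ‖c (l + 1) - x * c' l‖ ≤ _
      rw [sub_eq_add_neg]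
      refine (IsUltrametricDist.norm_add_le_max _ _).trans (max_le (hc _) ?_)
      rw [norm_neg, norm_mul, pow_succ']
      exact mul_le_mul hx ih (norm_nonneg _) hθ0
  refine ⟨c', hc', fun w hw => ?_⟩
  have hw0 : w ≠ 0 := norm_pos_iff.1 (zero_lt_one.trans_le hw)
  have hwx : w + x ≠ 0 := by
    have : ‖w‖ ≠ ‖x‖ := ((hx.trans_lt hθ).trans_le hw).ne'
    rw [← norm_pos_iff, IsUltrametricDist.norm_add_eq_max_of_norm_ne_norm this]
    exact lt_max_of_lt_left (zero_lt_one.trans_le hw)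
  have hsum : Summable fun l => c' l * w⁻¹ ^ (N + 1 + l) := by
    refine summable_of_norm_le_of_tendsto (g := fun l => θ ^ l) ?_ fun l => ?_
    · rw [Nat.cofinite_eq_atTop]
      exact tendsto_pow_atTop_nhds_zero_of_lt_one hθ0 hθ
    · rw [norm_mul, norm_pow, norm_inv]
      exact (mul_le_of_le_one_right (norm_nonneg _)
        (pow_le_one₀ (by positivity) (inv_le_one_of_one_le₀ hw))).trans (hc' l)
  obtain ⟨g, hg⟩ := hsum
  have h1 := hg.mul_left w
  have h2 : HasSum (fun l => Nat.casesOn l 0 fun l => x * (c' l * w⁻¹ ^ (N + 1 + l)) : ℕ → C)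
      (x * g) := by
    rw [← hasSum_nat_add_iff' 1]
    simpa using hg.mul_left x
  have h3 : w * g + x * g = f w := by
    refine (h1.add h2).unique ((hf w hw).congr_summand fun l => ?_)
    cases l with
    | zero =>
      change w * (c 0 * _) + 0 = _
      rw [add_zero, add_zero, add_zero, pow_succ]
      field_simp
    | succ l =>
      change w * ((c (l + 1) - x * c' l) * _) + x * (c' l * _) = _
      rw [show N + 1 + (l + 1) = (N + 1 + l) + 1 by ring, pow_succ,
        show N + (l + 1) = N + 1 + l by ring]
      field_simp
      ring
  rw [← h3, ← add_mul, inv_mul_cancel_left₀ hwx]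
  exact hg

theorem exists_expansion_inv_pow_mul_inv_pow {θ : ℝ} (hθ0 : 0 ≤ θ) (hθ : θ < 1) {x y : C}
    (hx : ‖x‖ ≤ θ) (hy : ‖y‖ ≤ θ) (i j : ℕ) :
    ∃ c : ℕ → C, (∀ l, ‖c l‖ ≤ θ ^ l) ∧ ∀ w, 1 ≤ ‖w‖ →
      HasSum (fun l => c l * w⁻¹ ^ (i + j + l)) ((w + x)⁻¹ ^ i * (w + y)⁻¹ ^ j) := by
  induction i with
  | zero =>
    induction j with
    | zero =>
      refine ⟨fun l => if l = 0 then 1 else 0, fun l => ?_, fun w _ => ?_⟩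
      · beta_reduce
        split_ifs with h
        · simp [h]
        · simpa using pow_nonneg hθ0 l
      · rw [pow_zero, pow_zero, mul_one]
        refine (hasSum_ite_eq 0 (1 : C)).congr_summand fun l => ?_
        split_ifs with h <;> simp [h]
    | succ j ih =>
      have := exists_expansion_inv_mul hθ0 hθ hy ih
      simpa only [pow_zero, one_mul, pow_succ', ← add_assoc] using this
  | succ i ih =>
    have := exists_expansion_inv_mul hθ0 hθ hx ih
    simpa only [pow_succ', mul_assoc, add_right_comm] using this

/-- A series of power series may be summed coefficientwise if the bounds of the coefficients tend
to `0`. -/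
theorem hasSum_tsum_mul_pow {ι : Type*} {a : ι → ℕ → C} {m : ι → ℝ} {s : ι → C} {u : C}
    (hm : Tendsto m cofinite (𝓝 0)) (ha : ∀ i j, ‖a i j‖ ≤ m i) (hu : ‖u‖ < 1)
    (hs : ∀ i, HasSum (fun j => a i j * u ^ j) (s i)) :
    HasSum (fun j => (∑' i, a i j) * u ^ j) (∑' i, s i) := by
  have hsum : Summable fun p : ι × ℕ => a p.1 p.2 * u ^ p.2 := by
    have hu' : Tendsto (fun j : ℕ => ‖u‖ ^ j) cofinite (𝓝 0) := by
      rw [Nat.cofinite_eq_atTop]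
      exact tendsto_pow_atTop_nhds_zero_of_lt_one (norm_nonneg _) hu
    refine summable_of_norm_le_of_tendsto (tendsto_mul_cofinite_nhds_zero hm hu') fun p => ?_
    rw [norm_mul, norm_pow]
    exact mul_le_mul_of_nonneg_right (ha _ _) (by positivity)
  have h1 := hsum.hasSum
  have h2 : ∑' p : ι × ℕ, a p.1 p.2 * u ^ p.2 = ∑' i, s i := by
    rw [hsum.tsum_prod]
    exact tsum_congr fun i => (hs i).tsum_eq
  rw [h2, ← (Equiv.prodComm ℕ ι).hasSum_iff] at h1
  refine h1.prod_fiberwise fun j => ?_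
  have h3 : Summable fun i => a i j := summable_of_norm_le_of_tendsto hm fun i => ha i j
  exact h3.hasSum.mul_right _

end Laurent

namespace DrinfeldPoincare

open Filter Topology

variable {F : Type*} [Field F] [Fintype F]

/-! ### Expansions at infinity -/

/-- `f` has for `|z|_i ≥ 2` an expansion `∑ a_i S_1(z)^i` with coefficients `|a_i| ≤ M`. The series
converges because `|S_1(z)| ≤ 1 / 2` there. -/
def HasExpansionAtInfty (f : CInfty F → CInfty F) (M : ℝ) : Prop :=
  ∃ a : ℕ → CInfty F, (∀ i, ‖a i‖ ≤ M) ∧ ∀ z ∈ Omega F, 2 ≤ imDist z →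
    HasSum (fun i => a i * latSum 1 z ^ i) (f z)

theorem norm_latSum_one_le {z : CInfty F} (hz : 2 ≤ imDist z) : ‖latSum 1 z‖ ≤ 2⁻¹ := by
  refine IsUltrametricDist.norm_tsum_le_of_forall_le_of_nonneg (by norm_num) fun a => ?_
  rw [pow_one, norm_inv]
  exact inv_anti₀ two_pos (hz.trans (imDist_le_norm_add z a))

namespace HasExpansionAtInfty

variable {f g : CInfty F → CInfty F} {M M' : ℝ}

theorem congr (hf : HasExpansionAtInfty f M)
    (h : ∀ z ∈ Omega F, 2 ≤ imDist z → g z = f z) : HasExpansionAtInfty g M := by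
  obtain ⟨a, ha, hs⟩ := hf
  exact ⟨a, ha, fun z hz hz2 => h z hz hz2 ▸ hs z hz hz2⟩

theorem mono (hf : HasExpansionAtInfty f M) (h : M ≤ M') : HasExpansionAtInfty f M' := by
  obtain ⟨a, ha, hs⟩ := hf
  exact ⟨a, fun i => (ha i).trans h, hs⟩

theorem add (hf : HasExpansionAtInfty f M) (hg : HasExpansionAtInfty g M) :
    HasExpansionAtInfty (fun z => f z + g z) M := by
  obtain ⟨a, ha, hs⟩ := hf
  obtain ⟨b, hb, ht⟩ := hg
  refine ⟨fun i => a i + b i, fun i =>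
    (IsUltrametricDist.norm_add_le_max _ _).trans (max_le (ha i) (hb i)), fun z hz hz2 => ?_⟩
  simpa only [add_mul] using (hs z hz hz2).add (ht z hz hz2)

theorem const_mul (hf : HasExpansionAtInfty f M) (x : CInfty F) :
    HasExpansionAtInfty (fun z => x * f z) (‖x‖ * M) := by
  obtain ⟨a, ha, hs⟩ := hf
  refine ⟨fun i => x * a i, fun i => ?_, fun z hz hz2 => ?_⟩
  · rw [norm_mul]; exact mul_le_mul_of_nonneg_left (ha i) (norm_nonneg _)
  · simpa only [mul_assoc] using (hs z hz hz2).mul_left x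

theorem sub (hf : HasExpansionAtInfty f M) (hg : HasExpansionAtInfty g M) :
    HasExpansionAtInfty (fun z => f z - g z) M := by
  have := hf.add ((hg.const_mul (-1)).mono (M' := M) (by simp))
  simpa [sub_eq_add_neg] using this

/-- A series of functions with expansions has an expansion, provided the coefficient bounds tend to
`0`. -/
theorem tsum {ι : Type*} {f : ι → CInfty F → CInfty F} {m : ι → ℝ} (hM : 0 ≤ M)
    (hm : Tendsto m cofinite (𝓝 0)) (hmM : ∀ i, m i ≤ M)
    (hf : ∀ i, HasExpansionAtInfty (f i) (m i)) :
    HasExpansionAtInfty (fun z => ∑' i, f i z) M := by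
  choose a ha hs using hf
  refine ⟨fun j => ∑' i, a i j, fun j =>
    IsUltrametricDist.norm_tsum_le_of_forall_le_of_nonneg hM fun i => (ha i j).trans (hmM i),
    fun z hz hz2 =>
    hasSum_tsum_mul_pow hm ha
      ((norm_latSum_one_le hz2).trans_lt (by norm_num)) fun i => hs i z hz hz2⟩

theorem sum {ι : Type*} {f : ι → CInfty F → CInfty F} (s : Finset ι) (hM : 0 ≤ M)
    (hf : ∀ i, HasExpansionAtInfty (f i) M) :
    HasExpansionAtInfty (fun z => ∑ i ∈ s, f i z) M := by
  classical
  induction s using Finset.induction_on with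
  | empty => exact ⟨0, fun i => by simpa using hM, fun z _ _ => by simp [hasSum_zero]⟩
  | insert i s hi ih =>
    simp only [Finset.sum_insert hi]
    exact (hf i).add ih

end HasExpansionAtInfty

theorem hasExpansionAtInfty_one : HasExpansionAtInfty (fun _ : CInfty F => 1) 1 := by
  refine ⟨fun i => if i = 0 then 1 else 0, fun i => by beta_reduce; split_ifs <;> simp,
    fun z _ _ => (hasSum_ite_eq 0 (1 : CInfty F)).congr_summand fun i => ?_⟩
  split_ifs with h <;> simp [h]

theorem hasExpansionAtInfty_latSum {j : ℕ} (hj : j ≠ 0) :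
    HasExpansionAtInfty (latSum j : CInfty F → CInfty F) 1 := by
  obtain ⟨G, hG1, hG2⟩ := exists_latSum_eq_eval (F := F) hj
  refine ⟨G.coeff, hG1, fun z hz _ => ?_⟩
  rw [hG2 z hz, Polynomial.eval_eq_sum_range]
  exact hasSum_sum_of_ne_finset_zero fun i hi => by
    rw [Polynomial.coeff_eq_zero_of_natDegree_lt (by simpa [Nat.lt_succ_iff] using hi), zero_mul]

/-- `∑_{β ∈ A} (z + β + x)^(-i) (z + β + y)^(-j)`. -/
noncomputable def mixedSum (x y : CInfty F) (i j : ℕ) (z : CInfty F) : CInfty F :=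
  ∑' β : F[X], (z + ofA β + x)⁻¹ ^ i * (z + ofA β + y)⁻¹ ^ j

theorem summable_mixedSum (x y : CInfty F) {i j : ℕ} (hij : i + j ≠ 0) (z : CInfty F) :
    Summable fun β : F[X] => (z + ofA β + x)⁻¹ ^ i * (z + ofA β + y)⁻¹ ^ j := by
  refine NonarchimedeanAddGroup.summable_of_tendsto_cofinite_zero ?_
  have h1 : ∀ x : CInfty F, Tendsto (fun β : F[X] => (z + ofA β + x)⁻¹) cofinite (𝓝 0) := by
    intro x
    simpa only [pow_one, add_right_comm] using tendsto_inv_pow (z + x) one_ne_zero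
  have h := ((h1 x).pow i).mul ((h1 y).pow j)
  have h0 : (0 : CInfty F) ^ i * 0 ^ j = 0 := by rw [← pow_add, zero_pow hij]
  rwa [h0] at h

/-- Shifts by polynomials: repeated use of `(w + x)⁻¹ w⁻¹ = x⁻¹ (w⁻¹ - (w + x)⁻¹)` with `|x| = 1`
reduces to the sums `S_j`. -/
theorem hasExpansionAtInfty_mixedSum_of_isUnit {x : F[X]} (hx : IsUnit x) {i j : ℕ}
    (hij : i + j ≠ 0) : HasExpansionAtInfty (mixedSum (ofA x) 0 i j) 1 := by
  obtain ⟨N, hN⟩ : ∃ N, i + j = N := ⟨_, rfl⟩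
  induction N generalizing i j with
  | zero => exact absurd hN hij
  | succ N ih =>
  obtain _ | i := i
  · refine (hasExpansionAtInfty_latSum (j := j) (by omega)).congr fun z _ _ => ?_
    simp only [mixedSum, pow_zero, one_mul, add_zero]
    rfl
  obtain _ | j := j
  · refine (hasExpansionAtInfty_latSum (j := i + 1) (by omega)).congr fun z _ _ => ?_
    rw [← latSum_add_ofA (i + 1) z x]
    simp only [mixedSum, pow_zero, mul_one, add_right_comm z _ (ofA x)]
    rfl
  have hx0 : ofA x ≠ 0 := by simpa using hx.ne_zero
  have h1 := (ih (i := i) (j := j + 1) (by omega) (by omega)).sub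
    (ih (i := i + 1) (j := j) (by omega) (by omega))
  have h2 := h1.const_mul (ofA x)⁻¹
  rw [norm_inv, norm_ofA_eq_one_of_isUnit hx, inv_one, one_mul] at h2
  refine h2.congr fun z hz _ => ?_
  rw [mixedSum, mixedSum, mixedSum, ← (summable_mixedSum _ _ (by omega) z).tsum_sub
    (summable_mixedSum _ _ (by omega) z), ← tsum_mul_left]
  refine tsum_congr fun β => ?_
  have hw := add_ofA_ne_zero hz β
  have hwx : z + ofA β + ofA x ≠ 0 := by
    simpa [add_assoc] using add_ofA_ne_zero hz (β + x)
  generalize z + ofA β = w at *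
  simp only [add_zero, inv_pow, pow_succ]
  field_simp
  ring

/-- If `|x|, |y| ≤ 1/q`, the summand expands as `∑ c_l (z + β)^(-i-j-l)` with `|c_l| ≤ q^(-l)`, and
summing over `β` first gives `∑ c_l S_{i+j+l}`. The decay of the `c_l` is needed because the
coefficients of the Goss polynomials are only bounded. -/
theorem hasExpansionAtInfty_mixedSum_of_norm_le {x y : CInfty F}
    (hx : ‖x‖ ≤ (Fintype.card F : ℝ)⁻¹) (hy : ‖y‖ ≤ (Fintype.card F : ℝ)⁻¹) {i j : ℕ}
    (hij : i + j ≠ 0) : HasExpansionAtInfty (mixedSum x y i j) 1 := by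
  have hθ0 : (0 : ℝ) ≤ (Fintype.card F : ℝ)⁻¹ := inv_nonneg.2 card_pos.le
  have hθ : (Fintype.card F : ℝ)⁻¹ < 1 := inv_lt_one_of_one_lt₀ one_lt_card
  have hpow : Tendsto (fun l : ℕ => ((Fintype.card F : ℝ)⁻¹) ^ l) cofinite (𝓝 0) := by
    rw [Nat.cofinite_eq_atTop]
    exact tendsto_pow_atTop_nhds_zero_of_lt_one hθ0 hθ
  obtain ⟨c, hc, hs⟩ := exists_expansion_inv_pow_mul_inv_pow hθ0 hθ hx hy i j
  have h1 := HasExpansionAtInfty.tsum (M := 1) zero_le_one hpow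
    (fun l => pow_le_one₀ hθ0 hθ.le) fun l => ((hasExpansionAtInfty_latSum (F := F)
      (j := i + j + l) (by omega)).const_mul (c l)).mono (by rw [mul_one]; exact hc l)
  refine h1.congr fun z hz hz2 => ?_
  have hz1 : ∀ β : F[X], 1 ≤ ‖z + ofA β‖ := fun β =>
    one_le_two.trans (hz2.trans (imDist_le_norm_add z β))
  have hsum : Summable (Function.uncurry fun (l : ℕ) (β : F[X]) =>
      c l * (z + ofA β)⁻¹ ^ (i + j + l)) := by
    refine summable_of_norm_le_of_tendsto
      (tendsto_mul_cofinite_nhds_zero hpow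
        (tendsto_zero_iff_norm_tendsto_zero.1 (tendsto_inv_pow z hij))) fun p => ?_
    rw [Function.uncurry, norm_mul, pow_add, norm_mul, norm_pow _ p.1]
    have h3 : ‖(z + ofA p.2)⁻¹‖ ^ p.1 ≤ 1 := by
      rw [norm_inv]
      exact pow_le_one₀ (by positivity) (inv_le_one_of_one_le₀ (hz1 _))
    exact mul_le_mul (hc _) (mul_le_of_le_one_right (norm_nonneg _) h3) (by positivity)
      (pow_nonneg hθ0 _)
  calc mixedSum x y i j z = ∑' β : F[X], ∑' l, c l * (z + ofA β)⁻¹ ^ (i + j + l) :=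
        tsum_congr fun β => (hs _ (hz1 β)).tsum_eq.symm
    _ = ∑' l, ∑' β : F[X], c l * (z + ofA β)⁻¹ ^ (i + j + l) := hsum.tsum_comm
    _ = _ := tsum_congr fun l => tsum_mul_left

/-- `∑_{β ∈ A} (a (z + β) + b)^(-n) (c (z + β) + d)^(-l)`. -/
noncomputable def rowSum (a b c d : F[X]) (n l : ℕ) (z : CInfty F) : CInfty F :=
  ∑' β : F[X], (ofA a * (z + ofA β) + ofA b)⁻¹ ^ n * (ofA c * (z + ofA β) + ofA d)⁻¹ ^ l

theorem eq_zero_of_degree_lt_of_isUnit {F : Type*} [Field F] {c d : F[X]}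
    (hdc : d.degree < c.degree) (hc : IsUnit c) :
    d = 0 := by
  rw [Polynomial.isUnit_iff_degree_eq_zero.1 hc] at hdc
  by_contra h
  exact absurd (Polynomial.zero_le_degree_iff.2 h) (not_le.2 hdc)

/-- With `a = 0` and a reduced bottom row, `b` and `c` are constants and `d = 0`. -/
theorem rowSum_of_eq_zero {b c d : F[X]} (hdet : 0 * d - b * c = 1) (hdc : d.degree < c.degree)
    (n l : ℕ) (z : CInfty F) :
    rowSum 0 b c d n l z = (ofA b)⁻¹ ^ n * (ofA c)⁻¹ ^ l * latSum l z := by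
  have hc : IsUnit c := .of_mul_eq_one (-b) (by linear_combination hdet)
  have hd := eq_zero_of_degree_lt_of_isUnit hdc hc
  rw [rowSum, latSum, ← tsum_mul_left]
  refine tsum_congr fun β => ?_
  simp only [hd, map_zero, zero_mul, zero_add, add_zero, mul_inv, mul_pow]
  ring

theorem rowSum_of_ne_zero {a c : F[X]} (ha : a ≠ 0) (hc : c ≠ 0) (b d : F[X]) (n l : ℕ)
    (z : CInfty F) : rowSum a b c d n l z =
      (ofA a)⁻¹ ^ n * (ofA c)⁻¹ ^ l * mixedSum (ofA b / ofA a) (ofA d / ofA c) n l z := by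
  rw [rowSum, mixedSum, ← tsum_mul_left]
  refine tsum_congr fun β => ?_
  have h : ∀ {a b : F[X]} {w : CInfty F}, a ≠ 0 →
      (ofA a * w + ofA b)⁻¹ = (ofA a)⁻¹ * (w + ofA b / ofA a)⁻¹ := fun {a b w} ha => by
    have : ofA a ≠ 0 := by simpa using ha
    rw [← mul_inv, mul_add, mul_div_cancel₀ _ this]
  rw [h ha, h hc, mul_pow, mul_pow]
  ring

/-- For a matrix of determinant `1` with reduced bottom row the poles `-b/a` and `-d/c` differ by
`1/(a c)`. Hence both have absolute value at most `1/q`, unless `a` and `c` are constants. -/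
theorem hasExpansionAtInfty_rowSum {a b c d : F[X]} (hdet : a * d - b * c = 1)
    (hdc : d.degree < c.degree) (n : ℕ) {l : ℕ} (hl : l ≠ 0) :
    HasExpansionAtInfty (rowSum a b c d n l) (‖ofA c‖⁻¹ ^ l * (max 1 ‖ofA a‖)⁻¹ ^ n) := by
  have hc : c ≠ 0 := by rintro rfl; simp at hdc
  rcases eq_or_ne a 0 with rfl | ha
  · have hb : IsUnit b := .of_mul_eq_one (-c) (by linear_combination hdet)
    refine (((hasExpansionAtInfty_latSum hl).const_mul
      ((ofA b)⁻¹ ^ n * (ofA c)⁻¹ ^ l)).congr fun z _ _ => rowSum_of_eq_zero hdet hdc n l z).mono ?_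
    rw [norm_mul, norm_pow, norm_pow, norm_inv, norm_inv, norm_ofA_eq_one_of_isUnit hb]
    simp
  suffices h : HasExpansionAtInfty (mixedSum (ofA b / ofA a) (ofA d / ofA c) n l) 1 by
    refine ((h.const_mul ((ofA a)⁻¹ ^ n * (ofA c)⁻¹ ^ l)).congr
      fun z _ _ => rowSum_of_ne_zero ha hc b d n l z).mono ?_
    rw [norm_mul, norm_pow, norm_pow, norm_inv, norm_inv, max_eq_right (one_le_norm_ofA ha),
      mul_one, mul_comm]
  have ha' : ofA a ≠ 0 := by simpa using ha
  have hc' : ofA c ≠ 0 := by simpa using hc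
  by_cases hu : IsUnit (a * c)
  -- Here `d = 0` and `b / a` is a nonzero constant.
  · obtain ⟨ha1, hc1⟩ := IsUnit.mul_iff.1 hu
    obtain ⟨a', haa'⟩ := ha1.exists_right_inv
    have hd := eq_zero_of_degree_lt_of_isUnit hdc hc1
    have hb : IsUnit b := .of_mul_eq_one (-c) (by rw [hd] at hdet; linear_combination hdet)
    have h1 : ofA b / ofA a = ofA (b * a') := by
      rw [div_eq_iff ha', ← map_mul, mul_assoc, mul_comm a', haa', mul_one]
    rw [h1, hd, map_zero, zero_div]
    exact hasExpansionAtInfty_mixedSum_of_isUnit (hb.mul (.of_mul_eq_one_right a haa')) (by omega)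
  -- Here `|a c| ≥ q` and `b / a = d / c - 1 / (a c)`.
  · have hd := norm_ofA_div_le hdc
    refine hasExpansionAtInfty_mixedSum_of_norm_le ?_ hd (by omega)
    have h1 : ofA b / ofA a = ofA d / ofA c + -(ofA (a * c))⁻¹ := by
      have := congrArg (ofA : F[X] →+* CInfty F) hdet
      simp only [map_sub, map_mul, map_one] at this ⊢
      field_simp
      linear_combination -this
    rw [h1]
    refine (IsUltrametricDist.norm_add_le_max _ _).trans (max_le hd ?_)
    rw [norm_neg, norm_inv]
    exact inv_anti₀ card_pos (card_le_norm_ofA hu (mul_ne_zero ha hc))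

end DrinfeldPoincare

namespace DrinfeldPoincare

open Filter Topology

/-! ### Representatives of `H \ Γ` modulo translations -/

section Representatives

variable {F : Type*} [Field F]

/-- The coprime pairs `(c, d)` with `deg d < deg c` (hence `c ≠ 0`): the bottom rows with `c ≠ 0`
modulo the translations `(c, d) ↦ (c, d + c β)`. -/
abbrev ReducedRow (F : Type*) [Field F] :=
  {p : F[X] × F[X] // p.2.degree < p.1.degree ∧ IsCoprime p.1 p.2}

theorem exists_matrix_of_isCoprime {c d : F[X]} (h : IsCoprime c d) :
    ∃ γ : Gam F, γ.val.det = 1 ∧ γ.val 1 0 = c ∧ γ.val 1 1 = d := by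
  obtain ⟨u, v, huv⟩ := h
  have hdet : (!![v, -u; c, d] : Matrix (Fin 2) (Fin 2) F[X]).det = 1 := by
    rw [Matrix.det_fin_two_of]
    linear_combination huv
  exact ⟨Matrix.GeneralLinearGroup.mk'' _ (hdet ▸ isUnit_one), hdet, rfl, rfl⟩

namespace ReducedRow

theorem fst_ne_zero (p : ReducedRow F) : p.1.1 ≠ 0 := by
  intro h
  have := p.2.1
  rw [h] at this
  simp at this

/-- A matrix of determinant `1` with the given bottom row. -/
noncomputable def matrix (p : ReducedRow F) : Gam F := (exists_matrix_of_isCoprime p.2.2).choose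

theorem det_matrix (p : ReducedRow F) : p.matrix.val.det = 1 :=
  (exists_matrix_of_isCoprime p.2.2).choose_spec.1

theorem matrix_one_zero (p : ReducedRow F) : p.matrix.val 1 0 = p.1.1 :=
  (exists_matrix_of_isCoprime p.2.2).choose_spec.2.1

theorem matrix_one_one (p : ReducedRow F) : p.matrix.val 1 1 = p.1.2 :=
  (exists_matrix_of_isCoprime p.2.2).choose_spec.2.2

theorem det_eq (p : ReducedRow F) (e : F[X]) :
    (p.matrix.val 0 0 + e * p.1.1) * p.1.2 - (p.matrix.val 0 1 + e * p.1.2) * p.1.1 = 1 := by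
  have h := p.det_matrix
  rw [Matrix.det_fin_two, matrix_one_zero, matrix_one_one] at h
  linear_combination h

end ReducedRow

/-- The translation matrix `z ↦ z + β`. -/
noncomputable def translation (β : F[X]) : Gam F :=
  Matrix.GeneralLinearGroup.mk'' !![1, β; 0, 1] (by simp [Matrix.det_fin_two_of])

/-- The scalar matrix of a nonzero constant. -/
noncomputable def scalarMatrix (x : Fˣ) : Gam F :=
  Matrix.GeneralLinearGroup.mk'' !![Polynomial.C x.1, 0; 0, Polynomial.C x.1]
    (by simp [Matrix.det_fin_two_of])

/-- Representatives of `H \ Γ`: scalar matrices for the cosets with `c = 0`, and translates of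
matrices with a reduced bottom row for the others. -/
noncomputable def cosetRep : Fˣ ⊕ (ReducedRow F × F[X]) → Gam F :=
  Sum.elim scalarMatrix fun p => p.1.matrix * translation p.2

theorem cosetRep_inl_row (x : Fˣ) : (cosetRep (.inl x)).val 1 0 = 0 ∧
    (cosetRep (.inl x)).val 1 1 = Polynomial.C x.1 := ⟨rfl, rfl⟩

theorem cosetRep_inr_row (p : ReducedRow F) (β : F[X]) :
    (cosetRep (.inr (p, β))).val 1 0 = p.1.1 ∧
      (cosetRep (.inr (p, β))).val 1 1 = p.1.1 * β + p.1.2 := by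
  have h : ∀ j, (cosetRep (.inr (p, β))).val 1 j =
      (p.matrix.val * !![1, β; 0, 1]) 1 j := fun _ => rfl
  rw [h, h, Matrix.mul_apply, Matrix.mul_apply, Fin.sum_univ_two, Fin.sum_univ_two,
    p.matrix_one_zero, p.matrix_one_one]
  simp

theorem bijective_cosetRep :
    Function.Bijective fun i => (⟦cosetRep i⟧ : Cosets F) := by
  constructor
  · intro i j hij
    have h := bottom_row_eq_of_coset_eq hij
    have h0 := congrFun h 0
    have h1 := congrFun h 1
    rcases i with x | ⟨p, β⟩ <;> rcases j with y | ⟨p', β'⟩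
    · rw [(cosetRep_inl_row x).2, (cosetRep_inl_row y).2, Polynomial.C_inj] at h1
      exact congrArg _ (Units.ext h1)
    · rw [(cosetRep_inl_row x).1, (cosetRep_inr_row p' β').1] at h0
      exact absurd h0.symm p'.fst_ne_zero
    · rw [(cosetRep_inl_row y).1, (cosetRep_inr_row p β).1] at h0
      exact absurd h0 p.fst_ne_zero
    · rw [(cosetRep_inr_row p β).1, (cosetRep_inr_row p' β').1] at h0
      rw [(cosetRep_inr_row p β).2, (cosetRep_inr_row p' β').2] at h1
      have hβ : β = β' := by
        by_contra hne
        have h2 : p.1.1 * (β - β') = p'.1.2 - p.1.2 := by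
          rw [← h0] at h1
          linear_combination h1
        have h3 := Polynomial.degree_le_mul_left p.1.1 (sub_ne_zero.2 hne)
        rw [h2] at h3
        refine absurd (h3.trans (Polynomial.degree_sub_le _ _)) (not_le.2 (max_lt ?_ p.2.1))
        rw [h0]
        exact p'.2.1
      rw [hβ, h0, add_right_inj] at h1
      rw [Subtype.ext (Prod.ext h0 h1) (a1 := p) (a2 := p'), hβ]
  · intro c
    obtain ⟨γ, rfl⟩ := Quotient.exists_rep c
    by_cases hc : γ.val 1 0 = 0
    · have hu := isUnit_det γ
      rw [Matrix.det_fin_two, hc, mul_zero, sub_zero] at hu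
      obtain ⟨x, hx, hx2⟩ := Polynomial.isUnit_iff.1 (isUnit_of_mul_isUnit_right hu)
      refine ⟨.inl hx.unit, coset_eq_of_bottom_row ?_⟩
      ext j : 1
      fin_cases j
      · exact hc.symm
      · exact hx2
    · have hcop : IsCoprime (γ.val 1 0) (γ.val 1 1) := by
        obtain ⟨u, hu⟩ := (isUnit_det γ).exists_left_inv
        rw [Matrix.det_fin_two] at hu
        exact ⟨-u * γ.val 0 1, u * γ.val 0 0, by linear_combination hu⟩
      have hdm := EuclideanDomain.div_add_mod (γ.val 1 1) (γ.val 1 0)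
      have hcop2 : IsCoprime (γ.val 1 0) (γ.val 1 1 % γ.val 1 0) := by
        rw [← hdm, add_comm] at hcop
        exact IsCoprime.of_add_mul_left_right hcop
      refine ⟨.inr (⟨(γ.val 1 0, γ.val 1 1 % γ.val 1 0),
        EuclideanDomain.mod_lt _ hc, hcop2⟩, γ.val 1 1 / γ.val 1 0), coset_eq_of_bottom_row ?_⟩
      ext j : 1
      fin_cases j
      · exact (cosetRep_inr_row _ _).1
      · exact (cosetRep_inr_row _ _).2.trans hdm

end Representatives

variable {F : Type*} [Field F] [Fintype F]

/-! ### The Poincaré series as a series over reduced rows -/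

theorem ReducedRow.tendsto_inv_max_one (p : ReducedRow F) (a : F[X]) :
    Tendsto (fun e : F[X] => (max 1 ‖ofA (a + e * p.1.1)‖)⁻¹) cofinite (𝓝 0) := by
  have hinj : Function.Injective fun e : F[X] => a + e * p.1.1 := fun e e' h =>
    mul_right_cancel₀ p.fst_ne_zero (add_left_cancel h)
  exact (tendsto_atTop_mono (fun e => le_max_right _ _)
    (tendsto_norm_ofA.comp hinj.tendsto_cofinite)).inv_tendsto_atTop

theorem moebius_translation (β : F[X]) (z : CInfty F) :
    moebius (translation β) z = z + ofA β := by
  have h : ∀ i j, entry (translation β) i j = ofA ((!![1, β; 0, 1] : Matrix _ _ F[X]) i j) :=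
    fun _ _ => rfl
  simp [moebius, jFactor, h]

theorem poincareTerm_mul_translation (π : CInfty F) (k n : ℕ) (γ : Gam F) (β : F[X])
    {z : CInfty F} (hz : z ∈ Omega F) :
    poincareTerm π k n (γ * translation β) z = poincareTerm π k n γ (z + ofA β) := by
  have h : ∀ i j, entry (translation β) i j = ofA ((!![1, β; 0, 1] : Matrix _ _ F[X]) i j) :=
    fun _ _ => rfl
  rw [poincareTerm_mul π k n γ _ hz, moebius_translation, detC_eq, jFactor]
  simp [h]

theorem poincareTerm_scalarMatrix (π : CInfty F) (k n : ℕ) (x : Fˣ) (z : CInfty F) :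
    poincareTerm π k n (scalarMatrix x) z =
      ofA (Polynomial.C x.1) ^ (2 * n) / ofA (Polynomial.C x.1) ^ k *
        (gossPoly π n).eval (unif π z) := by
  have h : ∀ i j, entry (scalarMatrix x) i j =
      ofA ((!![Polynomial.C x.1, 0; 0, Polynomial.C x.1] : Matrix _ _ F[X]) i j) := fun _ _ => rfl
  have hx : ofA (Polynomial.C x.1) ≠ 0 := ofA_C_ne_zero x.ne_zero
  have hm : moebius (scalarMatrix x) z = z := by
    simp only [moebius, jFactor, h]
    simp [mul_div_cancel_left₀ z hx]
  have hj : jFactor (scalarMatrix x) z = ofA (Polynomial.C x.1) := by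
    simp [jFactor, h]
  have hd : detC (scalarMatrix x) = ofA (Polynomial.C x.1) ^ 2 := by
    rw [detC_eq]
    simp [h, sq]
  rw [poincareTerm, slash, hm, hj, hd, ← pow_mul, mul_comm 2 (n % _), pow_mul,
    pow_mod_card_sub_one x.ne_zero, ← pow_mul, mul_comm n 2]

/-- The coset decomposition of `P_{k,n}`. The cosets with `c = 0` contribute a multiple of
`G_n(u(z))`, the others a series of `A`-periodic functions. -/
theorem poincareSeries_eq [DecidableEq F] {π : CInfty F} (hπ : π ≠ 0) {k n : ℕ} (hkn : n < k)
    {z : CInfty F}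
    (hz : z ∈ Omega F) : poincareSeries π k n z =
      (∑ x : Fˣ, ofA (Polynomial.C x.1) ^ (2 * n) / ofA (Polynomial.C x.1) ^ k) *
        (gossPoly π n).eval (unif π z) +
      ∑' p : ReducedRow F, ∑' β : F[X], poincareTerm π k n p.matrix (z + ofA β) := by
  let e := Equiv.ofBijective _ (bijective_cosetRep (F := F))
  have hs := summable_poincareTerm hπ hkn hz
  rw [← e.summable_iff] at hs
  have h : ∀ i, poincareTerm π k n (e i).out z = poincareTerm π k n (cosetRep i) z := fun i =>
    poincareTerm_out hπ k n _ hz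
  have hs' : Summable fun i => poincareTerm π k n (cosetRep i) z := hs.congr h
  have hs2 := hs'.comp_injective Sum.inr_injective
  rw [poincareSeries, ← e.tsum_eq, tsum_congr h,
    Summable.tsum_sum (hs'.comp_injective Sum.inl_injective) hs2, tsum_fintype, Finset.sum_mul]
  congr 1
  · exact Finset.sum_congr rfl fun x _ => poincareTerm_scalarMatrix π k n x z
  · refine hs2.tsum_prod.trans (tsum_congr fun p => tsum_congr fun β => ?_)
    exact poincareTerm_mul_translation π k n p.matrix β hz

theorem tsum_poincareTerm_zero (π : CInfty F) (k : ℕ) (p : ReducedRow F) (z : CInfty F) :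
    ∑' β : F[X], poincareTerm π k 0 p.matrix (z + ofA β) =
      rowSum (p.matrix.val 0 0) (p.matrix.val 0 1) p.1.1 p.1.2 0 k z := by
  refine tsum_congr fun β => ?_
  rw [poincareTerm_zero, pow_zero, one_mul, jFactor, entry, entry, p.matrix_one_zero,
    p.matrix_one_one]

/-- For `n ≥ 1` the translates of a term form a double series over `β` and over the top rows
`(a + e c, b + e d)`. Summing over `β` first gives a series of `rowSum`s. -/
theorem tsum_poincareTerm_eq {π : CInfty F} (hπ : π ≠ 0) {k n : ℕ} (hn : n ≠ 0) (hkn : n < k)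
    (p : ReducedRow F) {z : CInfty F} (hz : z ∈ Omega F) :
    ∑' β : F[X], poincareTerm π k n p.matrix (z + ofA β) =
      π⁻¹ ^ n * ∑' e : F[X], rowSum (p.matrix.val 0 0 + e * p.1.1)
        (p.matrix.val 0 1 + e * p.1.2) p.1.1 p.1.2 n (k - n) z := by
  have hdet : detC p.matrix = 1 := by rw [detC, p.det_matrix, map_one]
  have h : ∀ β : F[X], poincareTerm π k n p.matrix (z + ofA β) = π⁻¹ ^ n * ∑' e : F[X],
      (ofA (p.matrix.val 0 0 + e * p.1.1) * (z + ofA β) +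
        ofA (p.matrix.val 0 1 + e * p.1.2))⁻¹ ^ n *
        (ofA p.1.1 * (z + ofA β) + ofA p.1.2)⁻¹ ^ (k - n) := fun β => by
    rw [poincareTerm_eq hπ hn hkn _ (add_ofA_mem_Omega hz β), hdet, one_pow, mul_one, jFactor]
    simp only [entry, p.matrix_one_zero, p.matrix_one_one, map_add, map_mul]
  simp only [h]
  rw [tsum_mul_left]
  congr 1
  refine Summable.tsum_comm (f := fun (e β : F[X]) =>
    (ofA (p.matrix.val 0 0 + e * p.1.1) * (z + ofA β) +
        ofA (p.matrix.val 0 1 + e * p.1.2))⁻¹ ^ n *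
        (ofA p.1.1 * (z + ofA β) + ofA p.1.2)⁻¹ ^ (k - n)) ?_
  obtain ⟨r, hr⟩ := mem_Omega_iff.1 hz
  set Q : ℝ := ((Fintype.card F : ℝ) ^ r) ^ 2 with hQ'
  have hQ : 0 ≤ Q := pow_nonneg (pow_nonneg card_pos.le _) _
  have h1 : Tendsto (fun e : F[X] =>
      (Q * (max 1 ‖ofA (p.matrix.val 0 0 + e * p.1.1)‖)⁻¹) ^ n) cofinite (𝓝 0) := by
    simpa [hn] using ((p.tendsto_inv_max_one _).const_mul Q).pow n
  have hc : ofA p.1.1 ≠ 0 := by simpa using p.fst_ne_zero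
  have h2 : Tendsto (fun β : F[X] => ‖(ofA p.1.1 * (z + ofA β) + ofA p.1.2)⁻¹ ^ (k - n)‖)
      cofinite (𝓝 0) := by
    have h3 := ((tendsto_inv_pow (z + ofA p.1.2 / ofA p.1.1)
      (Nat.sub_ne_zero_of_lt hkn)).const_mul ((ofA p.1.1)⁻¹ ^ (k - n))).norm
    rw [mul_zero, norm_zero] at h3
    refine h3.congr fun β => ?_
    rw [← mul_pow, ← mul_inv, add_right_comm, mul_add _ (_ + _), mul_div_cancel₀ _ hc]
  refine summable_of_norm_le_of_tendsto (tendsto_mul_cofinite_nhds_zero h1 h2) fun q => ?_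
  rw [Function.uncurry, norm_mul, norm_pow]
  refine mul_le_mul_of_nonneg_right (pow_le_pow_left₀ (norm_nonneg _) ?_ _) (norm_nonneg _)
  have hdet' := p.det_eq q.1
  generalize p.matrix.val 0 0 + q.1 * p.1.1 = a at hdet' ⊢
  generalize p.matrix.val 0 1 + q.1 * p.1.2 = b at hdet' ⊢
  have hrow : a ≠ 0 ∨ a * q.2 + b ≠ 0 := by
    by_contra! h0
    obtain ⟨rfl, h0⟩ := h0
    rw [zero_mul, zero_add] at h0
    simp [h0] at hdet'
  have h5 := norm_inv_linear_le hr hrow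
  have h6 : ofA a * z + ofA (a * q.2 + b) = ofA a * (z + ofA q.2) + ofA b := by
    rw [map_add, map_mul]; ring
  rw [h6] at h5
  refine h5.trans (mul_le_mul_of_nonneg_left (inv_anti₀ (by positivity) ?_) hQ)
  exact max_le (one_le_max_norm hrow) (le_max_left _ _)

/-! ### The expansion of the Poincaré series at infinity -/

theorem inv_pow_le_one_of_one_le {x : ℝ} (hx : 1 ≤ x) (n : ℕ) : x⁻¹ ^ n ≤ 1 :=
  pow_le_one₀ (inv_nonneg.2 (zero_le_one.trans hx)) (inv_le_one_of_one_le₀ hx)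

theorem hasExpansionAtInfty_tsum_poincareTerm {π : CInfty F} (hπ : π ≠ 0) {k n : ℕ}
    (hkn : n < k) (p : ReducedRow F) :
    HasExpansionAtInfty (fun z => ∑' β : F[X], poincareTerm π k n p.matrix (z + ofA β))
      (‖π⁻¹ ^ n‖ * ‖ofA p.1.1‖⁻¹ ^ (k - n)) := by
  rcases eq_or_ne n 0 with rfl | hn
  · have hdet := p.det_eq 0
    simp only [zero_mul, add_zero] at hdet
    refine ((hasExpansionAtInfty_rowSum hdet p.2.1 0 (l := k) (by omega)).congr fun z _ _ =>
      tsum_poincareTerm_zero π k p z).mono ?_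
    simp
  refine ((HasExpansionAtInfty.tsum (M := ‖ofA p.1.1‖⁻¹ ^ (k - n)) (by positivity) ?_ ?_
    fun e => hasExpansionAtInfty_rowSum (p.det_eq e) p.2.1 n (l := k - n) (by omega)).const_mul
      (π⁻¹ ^ n)).congr fun z hz _ => tsum_poincareTerm_eq hπ hn hkn p hz
  · simpa [hn] using ((p.tendsto_inv_max_one _).pow n).const_mul (‖ofA p.1.1‖⁻¹ ^ (k - n))
  · exact fun e => mul_le_of_le_one_right (by positivity)
      (inv_pow_le_one_of_one_le (le_max_left _ _) n)

theorem ReducedRow.tendsto_norm : Tendsto (fun p : ReducedRow F => ‖ofA p.1.1‖) cofinite atTop := by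
  rw [tendsto_atTop]
  intro B
  have h := ((finite_norm_ofA_le (F := F) B).prod (finite_norm_ofA_le (F := F) B)).preimage
    (f := (Subtype.val : ReducedRow F → _)) Subtype.val_injective.injOn
  refine (h.subset fun p hp => ?_ : Set.Finite _)
  have hp : ‖ofA p.1.1‖ ≤ B := (not_le.1 fun h' => hp h').le
  refine ⟨hp, le_trans ?_ hp⟩
  have h1 := (norm_ofA_div_le p.2.1).trans (inv_le_one_of_one_le₀ one_lt_card.le)
  rwa [norm_div, div_le_one (norm_pos_iff.2 (by simpa using ReducedRow.fst_ne_zero p))] at h1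

theorem hasExpansionAtInfty_gossPoly {π : CInfty F} (hπ : π ≠ 0) (n : ℕ) :
    HasExpansionAtInfty (fun z => (gossPoly π n).eval (unif π z)) ‖π⁻¹ ^ n‖ := by
  rcases eq_or_ne n 0 with rfl | hn
  · simpa [gossPoly_zero] using hasExpansionAtInfty_one
  · exact ((((hasExpansionAtInfty_latSum hn).const_mul (π⁻¹ ^ n)).congr fun z hz _ =>
      gossPoly_eval hπ hn hz)).mono (by rw [mul_one])

theorem exists_hasExpansionAtInfty_poincareSeries {π : CInfty F} (hπ : π ≠ 0) {k n : ℕ}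
    (hkn : n < k) : ∃ M, HasExpansionAtInfty (poincareSeries π k n) M := by
  classical
  have h1 := (hasExpansionAtInfty_gossPoly hπ n).const_mul
    (∑ x : Fˣ, ofA (Polynomial.C x.1) ^ (2 * n) / ofA (Polynomial.C x.1) ^ k)
  have h2 := HasExpansionAtInfty.tsum (M := ‖π⁻¹ ^ n‖) (norm_nonneg _) (by
    simpa [Nat.sub_ne_zero_of_lt hkn] using
      (((ReducedRow.tendsto_norm (F := F)).inv_tendsto_atTop.pow (k - n)).const_mul ‖π⁻¹ ^ n‖))
    (fun p => mul_le_of_le_one_right (norm_nonneg _) (inv_pow_le_one_of_one_le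
      (one_le_norm_ofA p.fst_ne_zero) _)) (hasExpansionAtInfty_tsum_poincareTerm hπ hkn)
  exact ⟨_, ((h1.mono (le_max_left _ _)).add (h2.mono (le_max_right _ _))).congr fun z hz _ =>
    poincareSeries_eq hπ hkn hz⟩

theorem isDrinfeldModularForm_poincareSeries {π : CInfty F} (hπ : π ≠ 0) {k n : ℕ}
    (hkn : n < k) :
    IsDrinfeldModularForm π k (n % (Fintype.card F - 1)) (poincareSeries π k n) where
  rigidAnalytic := isRigidAnalytic_poincareSeries hπ hkn
  slash_eq γ _ hz := slash_poincareSeries hπ k n γ hz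
  holomorphic_at_infty := by
    obtain ⟨M, a, -, ha⟩ := exists_hasExpansionAtInfty_poincareSeries hπ hkn
    refine ⟨fun i => a i * π ^ i, 2, fun z hz hz2 => ?_⟩
    have h : ∀ i, a i * π ^ i * unif π z ^ i = a i * latSum 1 z ^ i := fun i => by
      rw [mul_assoc, ← mul_pow, unif_eq, mul_inv_cancel_left₀ hπ]
    simpa only [h] using ha z hz hz2

end DrinfeldPoincare

namespace DrinfeldPoincare

open Filter Topology

variable {F : Type*} [Field F] [Fintype F]

/-! ### Values at a point with `z ^ (q + 1) = T` -/

theorem exists_pow_eq_X : ∃ z : CInfty F, z ^ (Fintype.card F + 1) = ofA Polynomial.X := by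
  obtain ⟨y, hy⟩ := IsAlgClosed.exists_pow_nat_eq
    (algebraMap (KInfty F) (KInftyAlgCl F)
      (ratToKInfty (algebraMap F[X] (RatFunc F) Polynomial.X))) (Nat.succ_pos (Fintype.card F))
  refine ⟨UniformSpace.Completion.coeRingHom y, ?_⟩
  rw [← map_pow, hy]
  rfl

section SpecialPoint

variable {z : CInfty F} (hz : z ^ (Fintype.card F + 1) = ofA Polynomial.X)

include hz

theorem norm_pow_card_succ : ‖z‖ ^ (Fintype.card F + 1) = Fintype.card F := by
  rw [← norm_pow, hz, norm_ofA Polynomial.X_ne_zero, Polynomial.natDegree_X, pow_one]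

theorem one_lt_norm : 1 < ‖z‖ := by
  refine (one_lt_pow_iff_of_nonneg (norm_nonneg _) (Nat.succ_ne_zero (Fintype.card F))).1 ?_
  rw [norm_pow_card_succ hz]
  exact one_lt_card

theorem norm_pow_card_lt : ‖z‖ ^ Fintype.card F < Fintype.card F := by
  conv_rhs => rw [← norm_pow_card_succ hz]
  exact pow_lt_pow_right₀ (one_lt_norm hz) (Nat.lt_succ_self _)

theorem norm_lt_card : ‖z‖ < Fintype.card F :=
  (le_self_pow₀ (one_lt_norm hz).le Fintype.card_ne_zero).trans_lt (norm_pow_card_lt hz)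

theorem special_mem_Omega : z ∈ Omega F := by
  intro x hx
  have hn : ‖x‖ = ‖z‖ := by rw [← hx, norm_ofKInfty]
  have hx0 : 0 < ‖x‖ := by rw [hn]; exact zero_lt_one.trans (one_lt_norm hz)
  -- A nearby element of `K` has the same absolute value, which is therefore a power of `q`.
  obtain ⟨y, hy⟩ : ∃ y : WithAbs (absInfty F), ‖x - (y : KInfty F)‖ < ‖x‖ := by
    obtain ⟨_, hb, y, rfl⟩ := Metric.dense_iff.1
      (UniformSpace.Completion.denseRange_coe (α := WithAbs (absInfty F))) x ‖x‖ hx0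
    refine ⟨y, ?_⟩
    rwa [Metric.mem_ball, dist_comm, dist_eq_norm] at hb
  have hxy : ‖(y : KInfty F)‖ = ‖x‖ := by
    by_contra hne
    have h1 := IsUltrametricDist.norm_add_eq_max_of_norm_ne_norm (x := x) (y := -(y : KInfty F))
      (by rw [norm_neg]; exact Ne.symm hne)
    rw [← sub_eq_add_neg] at h1
    rw [h1] at hy
    exact absurd hy (not_lt.2 (le_max_left _ _))
  have h2 : ‖(y : KInfty F)‖ = absInfty F y.ofAbs := UniformSpace.Completion.norm_coe _
  have hy0 : y.ofAbs ≠ 0 := by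
    intro h0
    rw [h2, h0, map_zero] at hxy
    exact hx0.ne hxy
  rw [absInfty_of_ne_zero hy0, hxy, hn] at h2
  have h3 := norm_pow_card_succ hz
  rw [h2, ← zpow_natCast, ← zpow_mul] at h3
  have h4 := zpow_right_injective₀ card_pos one_lt_card.ne' (h3.trans (zpow_one _).symm)
  have h5 := Int.isUnit_iff.1 (IsUnit.of_mul_eq_one_right _ h4)
  have := Fintype.one_lt_card (α := F)
  omega

/-- Since `|z| = q^(1/(q+1))` is no power of `q`, there is no cancellation in `a z + b`. -/
theorem norm_special_linear (a b : F[X]) :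
    ‖ofA a * z + ofA b‖ = max (‖ofA a‖ * ‖z‖) ‖ofA b‖ := by
  by_cases ha : a = 0
  · simp [ha]
  by_cases hb : b = 0
  · simp [hb, mul_nonneg]
  rw [IsUltrametricDist.norm_add_eq_max_of_norm_ne_norm, norm_mul]
  intro h
  have h2 := congrArg (· ^ (Fintype.card F + 1)) h
  simp only [norm_mul, mul_pow, norm_pow_card_succ hz, norm_ofA ha, norm_ofA hb, ← pow_mul] at h2
  rw [← pow_succ] at h2
  have h3 := pow_right_injective₀ card_pos one_lt_card.ne' h2
  have h4 := congrArg (· % (Fintype.card F + 1)) h3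
  have h5 := Fintype.one_lt_card (α := F)
  simp only [Nat.mul_comm _ (Fintype.card F + 1), Nat.mul_add_mod] at h4
  rw [Nat.mod_eq_of_lt (by omega)] at h4
  simp at h4

theorem norm_add_ofA (b : F[X]) : ‖z + ofA b‖ = max ‖z‖ ‖ofA b‖ := by
  simpa using norm_special_linear hz 1 b

theorem norm_add_ofA_C (x : F) : ‖z + ofA (Polynomial.C x)‖ = ‖z‖ := by
  rw [norm_add_ofA hz, max_eq_left ((norm_ofA_C_le x).trans (one_lt_norm hz).le)]

theorem inv_card_pow_lt {j : ℕ} (hj : j ≠ 0) : (Fintype.card F : ℝ)⁻¹ ^ j < ‖z‖⁻¹ ^ j := by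
  have := one_lt_norm hz
  exact pow_lt_pow_left₀ (inv_strictAnti₀ (by positivity) (norm_lt_card hz))
    (inv_nonneg.2 card_pos.le) hj

/-- The constants contribute the main part of `S_j(z)`. -/
theorem exists_latSum_eq_add {j : ℕ} (hj : j ≠ 0) :
    ∃ R : CInfty F, ‖R‖ ≤ (Fintype.card F : ℝ)⁻¹ ^ j ∧
      latSum j z = ∑ x : F, (z + ofA (Polynomial.C x))⁻¹ ^ j + R := by
  let s : Finset F[X] := Finset.univ.map ⟨Polynomial.C, Polynomial.C_injective⟩
  refine ⟨∑' a : {a // a ∉ s}, (z + ofA a.1)⁻¹ ^ j, ?_, ?_⟩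
  · refine IsUltrametricDist.norm_tsum_le_of_forall_le_of_nonneg
      (pow_nonneg (inv_nonneg.2 card_pos.le) _) fun a => ?_
    have ha : ∀ x : F, Polynomial.C x ≠ a.1 := fun x hx => a.2 (by simp [s, ← hx])
    have hu : ¬ IsUnit a.1 := fun h => by
      obtain ⟨x, -, hx⟩ := Polynomial.isUnit_iff.1 h
      exact ha x hx
    have h0 : a.1 ≠ 0 := fun h => ha 0 (by rw [h, map_zero])
    rw [norm_pow, norm_inv, norm_add_ofA hz]
    exact pow_le_pow_left₀ (by positivity)
      (inv_anti₀ card_pos ((card_le_norm_ofA hu h0).trans (le_max_right _ _))) _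
  · rw [latSum, ← (summable_latSum z hj).sum_add_tsum_subtype_compl s, Finset.sum_map]
    rfl

/-- The constants contribute less than `|z|^(-j)`, because `∑_{x ∈ 𝔽_q} z^(-j) = 0`. -/
theorem norm_latSum_lt {j : ℕ} (hj : j ≠ 0) : ‖latSum j z‖ < ‖z‖⁻¹ ^ j := by
  have ht := one_lt_norm hz
  have ht0 : 0 < ‖z‖⁻¹ := inv_pos.2 (zero_lt_one.trans ht)
  have hz0 : z ≠ 0 := norm_pos_iff.1 (zero_lt_one.trans ht)
  obtain ⟨R, hR, h⟩ := exists_latSum_eq_add hz hj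
  rw [h]
  refine (IsUltrametricDist.norm_add_le_max _ _).trans_lt
    (max_lt ?_ (hR.trans_lt (inv_card_pow_lt hz hj)))
  have h1 : ∑ x : F, (z + ofA (Polynomial.C x))⁻¹ ^ j =
      ∑ x : F, ((z + ofA (Polynomial.C x))⁻¹ ^ j - z⁻¹ ^ j) := by
    rw [Finset.sum_sub_distrib, Finset.sum_const, Finset.card_univ, nsmul_eq_mul,
      card_cast_eq_zero, zero_mul, sub_zero]
  rw [h1, ← tsum_fintype (L := .unconditional _)]
  refine norm_tsum_lt_of_forall_lt (pow_pos ht0 _) fun x => ?_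
  have hx : ‖(z + ofA (Polynomial.C x))⁻¹‖ = ‖z‖⁻¹ := by rw [norm_inv, norm_add_ofA_C hz]
  have hzx : z + ofA (Polynomial.C x) ≠ 0 := add_ofA_ne_zero (special_mem_Omega hz) _
  refine norm_pow_sub_pow_lt ht0 hx.le (norm_inv z).le ?_ j
  have h2 : (z + ofA (Polynomial.C x))⁻¹ - z⁻¹ =
      -ofA (Polynomial.C x) * ((z + ofA (Polynomial.C x))⁻¹ * z⁻¹) := by
    field_simp
    ring
  rw [h2, norm_mul, norm_mul, hx, norm_inv, norm_neg]
  refine (mul_le_of_le_one_left (by positivity) (norm_ofA_C_le x)).trans_lt ?_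
  exact mul_lt_of_lt_one_left ht0 (inv_lt_one_of_one_lt₀ ht)

/-- Polynomials over `𝔽_q` take absolute value at least `1` at `z`, because their nonzero
coefficients have absolute value `1` and `|z| > 1`. -/
theorem one_le_norm_eval₂ {p : F[X]} (hp : p ≠ 0) :
    1 ≤ ‖p.eval₂ ((ofA : F[X] →+* CInfty F).comp Polynomial.C) z‖ := by
  suffices h : ∀ p : F[X], p ≠ 0 → 1 ≤ ‖p.eval₂ ((ofA : F[X] →+* CInfty F).comp Polynomial.C) z‖ ∧
      (p.coeff 0 = 0 → 1 < ‖p.eval₂ ((ofA : F[X] →+* CInfty F).comp Polynomial.C) z‖) from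
    (h p hp).1
  intro p
  induction p using Polynomial.recOnHorner with
  | M0 => exact fun h => absurd rfl h
  | MC p x hp hx ih =>
    refine fun _ => ⟨?_, fun h => absurd (by simpa [hp] using h) hx⟩
    have hC : ‖((ofA : F[X] →+* CInfty F).comp Polynomial.C) x‖ = 1 := norm_ofA_C hx
    rw [Polynomial.eval₂_add, Polynomial.eval₂_C]
    by_cases h0 : p = 0
    · simp only [h0, Polynomial.eval₂_zero, zero_add, hC, le_refl]
    · have h1 := (ih h0).2 hp
      rw [IsUltrametricDist.norm_add_eq_max_of_norm_ne_norm (by rw [hC]; exact h1.ne')]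
      exact le_max_of_le_left h1.le
  | MX p hp ih =>
    have h1 := (ih hp).1
    have h2 : 1 < ‖(p * Polynomial.X).eval₂ ((ofA : F[X] →+* CInfty F).comp Polynomial.C) z‖ := by
      rw [Polynomial.eval₂_mul, Polynomial.eval₂_X, norm_mul]
      exact one_lt_mul_of_le_of_lt h1 (one_lt_norm hz)
    exact fun _ => ⟨h2.le, fun _ => h2⟩

/-- The lower bound for `S_n(z)`: the contribution of the constants, multiplied by
`∏_{x ∈ 𝔽_q} (z + x)^n`, is the value at `z` of a nonzero polynomial over `𝔽_q`. -/
theorem le_norm_latSum {n : ℕ} (hn : n ≠ 0) : ‖z‖⁻¹ ^ (Fintype.card F * n) ≤ ‖latSum n z‖ := by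
  classical
  have ht := one_lt_norm hz
  have ht0 : 0 < ‖z‖ := zero_lt_one.trans ht
  obtain ⟨R, hR, h⟩ := exists_latSum_eq_add hz hn
  set f := ∑ x : F, (z + ofA (Polynomial.C x))⁻¹ ^ n with hf
  let N : F[X] := ∑ x : F, ∏ y ∈ Finset.univ.erase x, (Polynomial.X + Polynomial.C y) ^ n
  have hN : N ≠ 0 := by
    -- At `0` only the summand `x = 0` survives.
    intro h0
    have h1 := congrArg (Polynomial.eval 0) h0
    simp only [N, Polynomial.eval_finsetSum, Polynomial.eval_prod, Polynomial.eval_pow,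
      Polynomial.eval_add, Polynomial.eval_X, Polynomial.eval_C, zero_add,
      Polynomial.eval_zero] at h1
    rw [Finset.sum_eq_single 0] at h1
    · rw [Finset.prod_eq_zero_iff] at h1
      obtain ⟨y, hy, hy0⟩ := h1
      exact Finset.ne_of_mem_erase hy (pow_eq_zero_iff hn |>.1 hy0)
    · intro x _ hx
      exact Finset.prod_eq_zero (Finset.mem_erase.2 ⟨hx.symm, Finset.mem_univ _⟩) (zero_pow hn)
    · simp
  have hprod : ‖∏ y : F, (z + ofA (Polynomial.C y)) ^ n‖ = ‖z‖ ^ (Fintype.card F * n) := by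
    rw [norm_prod]
    simp only [norm_pow, norm_add_ofA_C hz]
    rw [Finset.prod_const, Finset.card_univ, ← pow_mul, mul_comm]
  have hfN : f * ∏ y : F, (z + ofA (Polynomial.C y)) ^ n =
      N.eval₂ ((ofA : F[X] →+* CInfty F).comp Polynomial.C) z := by
    simp only [N, Polynomial.eval₂_finsetSum, Polynomial.eval₂_finsetProd, Polynomial.eval₂_pow,
      Polynomial.eval₂_add, Polynomial.eval₂_X, Polynomial.eval₂_C, RingHom.comp_apply]
    rw [hf, Finset.sum_mul]
    refine Finset.sum_congr rfl fun x _ => ?_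
    rw [← Finset.mul_prod_erase _ _ (Finset.mem_univ x), ← mul_assoc, ← mul_pow,
      inv_mul_cancel₀ (add_ofA_ne_zero (special_mem_Omega hz) _), one_pow, one_mul]
  have hf1 : ‖z‖⁻¹ ^ (Fintype.card F * n) ≤ ‖f‖ := by
    have h1 := one_le_norm_eval₂ hz hN
    rw [← hfN, norm_mul, hprod] at h1
    rwa [inv_pow, inv_le_iff_one_le_mul₀ (pow_pos ht0 _)]
  have hRf : ‖R‖ < ‖f‖ := by
    refine (hR.trans_lt ?_).trans_le hf1
    rw [pow_mul, inv_pow ‖z‖]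
    exact pow_lt_pow_left₀ (inv_strictAnti₀ (pow_pos ht0 _) (norm_pow_card_lt hz))
      (inv_nonneg.2 card_pos.le) hn
  rw [h, IsUltrametricDist.norm_add_eq_max_of_norm_ne_norm hRf.ne']
  exact hf1.trans (le_max_left _ _)

theorem norm_inv_special_linear_le {a : F[X]} (ha : a ≠ 0) (b β : F[X]) :
    ‖(ofA a * (z + ofA β) + ofA b)⁻¹‖ ≤ ‖z‖⁻¹ := by
  have h : ofA a * (z + ofA β) + ofA b = ofA a * z + ofA (a * β + b) := by
    rw [map_add, map_mul]; ring
  rw [h, norm_inv, norm_special_linear hz]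
  have ht := one_lt_norm hz
  exact inv_anti₀ (by positivity)
    ((le_mul_of_one_le_left (by positivity) (one_le_norm_ofA ha)).trans (le_max_left _ _))

theorem norm_rowSum_le {a c : F[X]} {n : ℕ} (ha : n = 0 ∨ a ≠ 0) (hc : c ≠ 0) (b d : F[X])
    (l : ℕ) : ‖rowSum a b c d n l z‖ ≤ ‖z‖⁻¹ ^ (n + l) := by
  refine IsUltrametricDist.norm_tsum_le_of_forall_le_of_nonneg (by positivity) fun β => ?_
  rw [norm_mul, norm_pow, norm_pow, pow_add]
  have h1 := pow_le_pow_left₀ (norm_nonneg _) (norm_inv_special_linear_le hz hc d β) l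
  refine mul_le_mul ?_ h1 (by positivity) (by positivity)
  rcases ha with rfl | ha
  · simp
  · exact pow_le_pow_left₀ (norm_nonneg _) (norm_inv_special_linear_le hz ha b β) n

/-- The condition `(q + 1) n ≤ k` enters here. If `a ≠ 0` the sum is at most `|z|^(-k)`; if `a = 0`
it is `S_{k-n}(z)` up to a constant of absolute value `1`, and `k - n ≥ q n`. -/
theorem norm_rowSum_lt {a b c d : F[X]} (hdet : a * d - b * c = 1) (hdc : d.degree < c.degree)
    {k n : ℕ} (hn : n ≠ 0) (hk : (Fintype.card F + 1) * n ≤ k) :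
    ‖rowSum a b c d n (k - n) z‖ < ‖z‖⁻¹ ^ (Fintype.card F * n) := by
  have ht := one_lt_norm hz
  have ht0 : 0 < ‖z‖⁻¹ := inv_pos.2 (zero_lt_one.trans ht)
  have ht1 : ‖z‖⁻¹ < 1 := inv_lt_one_of_one_lt₀ ht
  have hc : c ≠ 0 := by rintro rfl; simp at hdc
  have hqn : 0 < Fintype.card F * n := Nat.mul_pos Fintype.card_pos (Nat.pos_of_ne_zero hn)
  rw [add_mul, one_mul] at hk
  rcases eq_or_ne a 0 with rfl | ha
  · have hb1 : IsUnit b := .of_mul_eq_one (-c) (by linear_combination hdet)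
    have hc1 : IsUnit c := .of_mul_eq_one (-b) (by linear_combination hdet)
    rw [rowSum_of_eq_zero hdet hdc, norm_mul, norm_mul, norm_pow, norm_pow, norm_inv, norm_inv,
      norm_ofA_eq_one_of_isUnit hb1, norm_ofA_eq_one_of_isUnit hc1, inv_one, one_pow, one_pow,
      one_mul, one_mul]
    exact (norm_latSum_lt hz (by omega)).trans_le
      (pow_le_pow_of_le_one ht0.le ht1.le (by omega))
  · refine (norm_rowSum_le hz (Or.inr ha) hc b d _).trans_lt ?_
    exact pow_lt_pow_right_of_lt_one₀ ht0 ht1 (by omega)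

theorem norm_tsum_reducedRow_lt {π : CInfty F} (hπ : π ≠ 0) {k n : ℕ} (hkn : n < k)
    (hk : (Fintype.card F + 1) * n ≤ k) :
    ‖∑' p : ReducedRow F, ∑' β : F[X], poincareTerm π k n p.matrix (z + ofA β)‖ <
      ‖π⁻¹ ^ n‖ * ‖z‖⁻¹ ^ (Fintype.card F * n) := by
  have ht := one_lt_norm hz
  have ht0 : 0 < ‖z‖⁻¹ := inv_pos.2 (zero_lt_one.trans ht)
  have hπn : 0 < ‖π⁻¹ ^ n‖ := norm_pos_iff.2 (pow_ne_zero _ (inv_ne_zero hπ))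
  refine norm_tsum_lt_of_forall_lt (by positivity) fun p => ?_
  rcases eq_or_ne n 0 with rfl | hn
  · rw [tsum_poincareTerm_zero]
    refine (norm_rowSum_le hz (Or.inl rfl) p.fst_ne_zero _ _ _).trans_lt ?_
    simpa using pow_lt_one₀ ht0.le (inv_lt_one_of_one_lt₀ ht) hkn.ne'
  · rw [tsum_poincareTerm_eq hπ hn hkn p (special_mem_Omega hz), norm_mul]
    exact mul_lt_mul_of_pos_left (norm_tsum_lt_of_forall_lt (by positivity) fun e =>
      norm_rowSum_lt hz (p.det_eq e) p.2.1 hn hk) hπn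

end SpecialPoint

theorem sum_units_pow_div_pow [DecidableEq F] {k n : ℕ} (h : k ≡ 2 * n [MOD Fintype.card F - 1]) :
    ∑ x : Fˣ, ofA (Polynomial.C x.1) ^ (2 * n) / ofA (Polynomial.C x.1) ^ k = -1 := by
  have h1 : ∀ x : Fˣ, ofA (Polynomial.C x.1) ^ (2 * n) / ofA (Polynomial.C x.1) ^ k = 1 := by
    intro x
    rw [← pow_mod_card_sub_one x.ne_zero k, ← pow_mod_card_sub_one x.ne_zero (2 * n), h]
    exact div_self (pow_ne_zero _ (ofA_C_ne_zero x.ne_zero))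
  simp only [h1]
  rw [Finset.sum_const, Finset.card_univ, Fintype.card_units, nsmul_eq_mul, mul_one,
    Nat.cast_sub Fintype.card_pos, card_cast_eq_zero, Nat.cast_one, zero_sub]

/-- At the chosen point the part of `P_{k,n}` with `c = 0` is `-G_n(u(z))`, which is larger in
absolute value than everything else. -/
theorem exists_poincareSeries_ne_zero {π : CInfty F} (hπ : π ≠ 0) {k n : ℕ} (hkn : n < k)
    (hmod : k ≡ 2 * n [MOD Fintype.card F - 1]) (hk : (Fintype.card F + 1) * n ≤ k) :
    ∃ z ∈ Omega F, poincareSeries π k n z ≠ 0 := by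
  classical
  obtain ⟨z, hz⟩ := exists_pow_eq_X (F := F)
  have hzO := special_mem_Omega hz
  refine ⟨z, hzO, fun h0 => ?_⟩
  rw [poincareSeries_eq hπ hkn hzO, sum_units_pow_div_pow hmod, neg_one_mul,
    neg_add_eq_zero] at h0
  have h1 := norm_tsum_reducedRow_lt hz hπ hkn hk
  rw [← h0] at h1
  refine absurd h1 (not_lt.2 ?_)
  rcases eq_or_ne n 0 with rfl | hn
  · simp [gossPoly_zero]
  · rw [gossPoly_eval hπ hn hzO, norm_mul]
    exact mul_le_mul_of_nonneg_left (le_norm_latSum hz hn) (norm_nonneg _)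

end DrinfeldPoincare

theorem mainTheorem2 {F : Type*} [Field F] [Fintype F] (π : CInfty F)
    (hπ : IsFundamentalPeriod π) (k n : ℕ) (hkn : n < k) :
    (∀ z ∈ Omega F,
      (∀ h ∈ subgroupH F, ∀ γ : Gam F, poincareTerm π k n (h * γ) z = poincareTerm π k n γ z) ∧
      Summable (fun c : Cosets F => poincareTerm π k n (Quotient.out c) z)) ∧
    IsDrinfeldModularForm π k (n % (Fintype.card F - 1)) (poincareSeries π k n) ∧
    (k ≡ 2 * n [MOD Fintype.card F - 1] → (n : ℝ) ≤ (k : ℝ) / ((Fintype.card F : ℝ) + 1) →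
      ∃ z ∈ Omega F, poincareSeries π k n z ≠ 0) := by
  refine ⟨fun z hz => ⟨fun h hh γ => poincareTerm_subgroupH_mul hπ.1 k n hh γ hz,
    summable_poincareTerm hπ.1 hkn hz⟩, isDrinfeldModularForm_poincareSeries hπ.1 hkn,
    fun hmod hle => exists_poincareSeries_ne_zero hπ.1 hkn hmod ?_⟩
  rw [le_div_iff₀ (by positivity)] at hle
  rw [mul_comm]
  exact_mod_cast hle
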